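/- **Proposition.** All manifolds are $C^\infty$, finite-dimensional, Hausdorff and without boundary. For a manifold $M$ let $T^{big}M=TM\oplus T^*M$, with the pairing $g((X,\alpha),(Y,\beta))=\tfrac12(\alpha(Y)+\beta(X))$ and the Courant bracket of sections $$[(X,\alpha),(Y,\beta)]=\big([X,Y],\ L_X\beta-L_Y\alpha+\tfrac12 d(\alpha(Y)-\beta(X))\big).$$ A *big-isotropic structure* on $M$ is a smooth $g$-isotropic subbundle $E\subseteq T^{big}M$ of some constant rank; it is *integrable* if its space of smooth global sections is closed under the Courant bracket. $E'=E^{\perp_g}$ denotes its $g$-orthogonal. For a smooth map $f:N\to M$, $x\in N$, $y=f(x)$, and subspaces $E_y\subseteq T_y^{big}M$, $L_x\subseteq T^{big}_xN$, put $$f^*(E_y)=\{(X,f^*\alpha) : X\in T_xN,\ \alpha\in T_y^*M,\ (f_*X,\alpha)\in E_y\},\qquad f_*(L_x)=\{(f_*X,\alpha) : X\in T_xN,\ \alpha\in T_y^*M,\ (X,f^*\alpha)\in L_x\}.$$ Let $E$ be an integrable big-isotropic structure on $M$ and let $\iota:N\to M$ be an embedded submanifold such that the subspaces $E\cap(TN\oplus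 T^*_NM)$ and $E'\cap(TN\oplus T^*_NM)$ have constant dimension along $N$. Let $\pi:N\to Q$ be a surjective submersion with connected fibres, and let $\mathcal F$ be the foliation of $N$ whose leaves are the fibres of $\pi$. Assume that the natural projection $E\cap(T\mathcal F\oplus \mathrm{ann}\,TN)\to T\mathcal F$ is surjective at every point of $N$, where $\mathrm{ann}\,TN\subseteq T^*_NM$ is the annihilator of $TN$; that is, for all $x\in N$ and $Z\in T_x\mathcal F$ there is $\alpha\in\mathrm{ann}\,T_xN$ with $(\iota_*Z,\alpha)\in E_{\iota(x)}$. Then there is a unique integrable big-isotropic structure $E^{red}$ on $Q$ such that $E^{red}=\pi_*(\iota^*E)$ and $\pi^*E^{red}=\iota^*E$, i.e. for every $x\in N$ $$E^{red}_{\pi(x)}=\pi_*\big((\iota^*E)_x\big)\quad\text{and}\quad \pi^*\big(E^{red}_{\pi(x)}\big)=(\iota^*E)_x,\qquad (\iota^*E)_x:=\iota^*(E_{\iota(x)}).$$ -/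

import Mathlib

open Manifold VectorField
open scoped ContDiff

noncomputable section

/-! ### Linear algebra of `W ⊕ W*` -/

/-- The big space `W ⊕ W*`. -/
abbrev Big (W : Type*) [AddCommGroup W] [Module ℝ W] [TopologicalSpace W] : Type _ :=
  W × (W →L[ℝ] ℝ)

/-- The neutral metric `g((X, α), (Y, β)) = (α(Y) + β(X)) / 2` on `W ⊕ W*`. -/
def bigMetric (W : Type*) [AddCommGroup W] [Module ℝ W] [TopologicalSpace W]
    [IsTopologicalAddGroup W] [ContinuousSMul ℝ W] : LinearMap.BilinForm ℝ (Big W) :=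
  LinearMap.mk₂ ℝ (fun u v => (1 / 2 : ℝ) * (u.2 v.1 + v.2 u.1))
    (by intros; simp; ring) (by intros; simp; ring)
    (by intros; simp; ring) (by intros; simp; ring)

/-- The pullback `l^*E = {(X, l^*α) | (l X, α) ∈ E} ⊆ W₁ ⊕ W₁*` of `E ⊆ W₂ ⊕ W₂*`
by a linear map `l : W₁ → W₂`. -/
def bigPullback {W₁ W₂ : Type*}
    [AddCommGroup W₁] [Module ℝ W₁] [TopologicalSpace W₁]
    [IsTopologicalAddGroup W₁] [ContinuousSMul ℝ W₁]
    [AddCommGroup W₂] [Module ℝ W₂] [TopologicalSpace W₂]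
    [IsTopologicalAddGroup W₂] [ContinuousSMul ℝ W₂]
    (l : W₁ →L[ℝ] W₂) (E : Submodule ℝ (Big W₂)) : Submodule ℝ (Big W₁) where
  carrier := {u | ∃ α : W₂ →L[ℝ] ℝ, (l u.1, α) ∈ E ∧ u.2 = α.comp l}
  zero_mem' := ⟨0, by simp [← Prod.zero_eq_mk, E.zero_mem], by simp⟩
  add_mem' := by
    rintro u v ⟨α, hα, hu⟩ ⟨β, hβ, hv⟩
    exact ⟨α + β, by simpa using E.add_mem hα hβ, by simp [hu, hv]⟩
  smul_mem' := by
    rintro c u ⟨α, hα, hu⟩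
    exact ⟨c • α, by simpa using E.smul_mem c hα, by simp [hu]⟩

/-- The push-forward `l_*E = {(l X, α) | (X, l^*α) ∈ E} ⊆ W₂ ⊕ W₂*` of `E ⊆ W₁ ⊕ W₁*`
by a linear map `l : W₁ → W₂`. -/
def bigPushforward {W₁ W₂ : Type*}
    [AddCommGroup W₁] [Module ℝ W₁] [TopologicalSpace W₁]
    [IsTopologicalAddGroup W₁] [ContinuousSMul ℝ W₁]
    [AddCommGroup W₂] [Module ℝ W₂] [TopologicalSpace W₂]
    [IsTopologicalAddGroup W₂] [ContinuousSMul ℝ W₂]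
    (l : W₁ →L[ℝ] W₂) (E : Submodule ℝ (Big W₁)) : Submodule ℝ (Big W₂) where
  carrier := {v | ∃ X : W₁, (X, v.2.comp l) ∈ E ∧ v.1 = l X}
  zero_mem' := ⟨0, by simp [← Prod.zero_eq_mk, E.zero_mem], by simp⟩
  add_mem' := by
    rintro u v ⟨X, hX, hu⟩ ⟨Y, hY, hv⟩
    exact ⟨X + Y, by simpa using E.add_mem hX hY, by simp [hu, hv]⟩
  smul_mem' := by
    rintro c u ⟨X, hX, hu⟩
    exact ⟨c • X, by simpa using E.smul_mem c hX, by simp [hu]⟩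

/-! ### The big tangent bundle of a manifold

Manifolds are modelled on a real normed space `V` (finite-dimensional in the theorem), without
boundary. -/

/-- The fibre `T_xM ⊕ T_x^*M` of the big tangent bundle at `x`. -/
abbrev BigTangent (V : Type*) [NormedAddCommGroup V] [NormedSpace ℝ V]
    {M : Type*} [TopologicalSpace M] [ChartedSpace V M] (x : M) : Type _ :=
  Big (TangentSpace 𝓘(ℝ, V) x)

/-- `σ = (X, α)` is a smooth section of the big tangent bundle over `s`: the vector field `X`
and the 1-form `α` are both smooth on `s`. -/
structure IsSmoothBigSectionOn {V : Type*} [NormedAddCommGroup V] [NormedSpace ℝ V]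
    {M : Type*} [TopologicalSpace M] [ChartedSpace V M] [IsManifold 𝓘(ℝ, V) ∞ M]
    (σ : ∀ x : M, BigTangent V x) (s : Set M) : Prop where
  vectorField : ContMDiffOn 𝓘(ℝ, V) 𝓘(ℝ, V).tangent ∞
    (fun x => (⟨x, (σ x).1⟩ : TangentBundle 𝓘(ℝ, V) M)) s
  oneForm : ContMDiffOn 𝓘(ℝ, V) (𝓘(ℝ, V).prod 𝓘(ℝ, V →L[ℝ] ℝ)) ∞
    (fun x => Bundle.TotalSpace.mk' (V →L[ℝ] ℝ)
      (E := fun y : M => TangentSpace 𝓘(ℝ, V) y →L[ℝ] ℝ) x (σ x).2) s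

/-- The coordinate expression `V → V` of a vector field in the preferred chart at `x`. -/
def chartVectorField {V : Type*} [NormedAddCommGroup V] [NormedSpace ℝ V]
    {M : Type*} [TopologicalSpace M] [ChartedSpace V M]
    (x : M) (X : ∀ y : M, TangentSpace 𝓘(ℝ, V) y) : V → V :=
  mpullback 𝓘(ℝ, V) 𝓘(ℝ, V) (extChartAt 𝓘(ℝ, V) x).symm X

/-- The coordinate expression `V → V*` of a 1-form in the preferred chart at `x`. -/
def chartOneForm {V : Type*} [NormedAddCommGroup V] [NormedSpace ℝ V]
    {M : Type*} [TopologicalSpace M] [ChartedSpace V M]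
    (x : M) (β : ∀ y : M, TangentSpace 𝓘(ℝ, V) y →L[ℝ] ℝ) : V → V →L[ℝ] ℝ :=
  fun v => (β ((extChartAt 𝓘(ℝ, V) x).symm v)).comp
    (mfderiv 𝓘(ℝ, V) 𝓘(ℝ, V) (extChartAt 𝓘(ℝ, V) x).symm v)

/-- The Lie derivative `L_X β` of a 1-form along a vector field at `x`, computed in the preferred
chart at `x`: there it is `(L_X β)_i = X^j ∂_j β_i + β_j ∂_i X^j`. -/
def lieDerivOneForm {V : Type*} [NormedAddCommGroup V] [NormedSpace ℝ V]
    {M : Type*} [TopologicalSpace M] [ChartedSpace V M]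
    (X : ∀ y : M, TangentSpace 𝓘(ℝ, V) y) (β : ∀ y : M, TangentSpace 𝓘(ℝ, V) y →L[ℝ] ℝ)
    (x : M) : TangentSpace 𝓘(ℝ, V) x →L[ℝ] ℝ :=
  let a : V := extChartAt 𝓘(ℝ, V) x x
  (fderiv ℝ (chartOneForm x β) a (chartVectorField x X a)
    + (chartOneForm x β a).comp (fderiv ℝ (chartVectorField x X) a)).comp
    (mfderiv 𝓘(ℝ, V) 𝓘(ℝ, V) (extChartAt 𝓘(ℝ, V) x) x)

/-- The differential of a real function, as a 1-form. -/
def dFun {V : Type*} [NormedAddCommGroup V] [NormedSpace ℝ V]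
    {M : Type*} [TopologicalSpace M] [ChartedSpace V M] (f : M → ℝ) (x : M) :
    TangentSpace 𝓘(ℝ, V) x →L[ℝ] ℝ :=
  mfderiv 𝓘(ℝ, V) 𝓘(ℝ, ℝ) f x

/-- The Courant bracket
`[(X, α), (Y, β)] = ([X, Y], L_X β - L_Y α + (1/2) d(α(Y) - β(X)))`. -/
def courantBracket {V : Type*} [NormedAddCommGroup V] [NormedSpace ℝ V]
    {M : Type*} [TopologicalSpace M] [ChartedSpace V M]
    (σ τ : ∀ x : M, BigTangent V x) (x : M) : BigTangent V x :=
  (mlieBracket 𝓘(ℝ, V) (fun y => (σ y).1) (fun y => (τ y).1) x,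
    lieDerivOneForm (fun y => (σ y).1) (fun y => (τ y).2) x
      - lieDerivOneForm (fun y => (τ y).1) (fun y => (σ y).2) x
      + (1 / 2 : ℝ) • dFun (fun y => (σ y).2 (τ y).1 - (τ y).2 (σ y).1) x)

/-- The field of subspaces `E` is a smooth subbundle of rank `k` of the big tangent bundle:
it has local frames consisting of `k` smooth sections. -/
def IsSmoothBigSubbundle {V : Type*} [NormedAddCommGroup V] [NormedSpace ℝ V]
    {M : Type*} [TopologicalSpace M] [ChartedSpace V M] [IsManifold 𝓘(ℝ, V) ∞ M]
    (k : ℕ) (E : ∀ x : M, Submodule ℝ (BigTangent V x)) : Prop :=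
  ∀ x₀ : M, ∃ U : Set M, IsOpen U ∧ x₀ ∈ U ∧
    ∃ s : Fin k → ∀ x : M, BigTangent V x,
      (∀ i, IsSmoothBigSectionOn (s i) U) ∧
      ∀ x ∈ U, LinearIndependent ℝ (fun i => s i x) ∧
        Submodule.span ℝ (Set.range fun i => s i x) = E x

/-- The `g`-orthogonal field of subspaces `E'`. -/
def bigOrthogonal {V : Type*} [NormedAddCommGroup V] [NormedSpace ℝ V]
    {M : Type*} [TopologicalSpace M] [ChartedSpace V M]
    (E : ∀ x : M, Submodule ℝ (BigTangent V x)) (x : M) : Submodule ℝ (BigTangent V x) :=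
  (bigMetric (TangentSpace 𝓘(ℝ, V) x)).orthogonal (E x)

/-- A big-isotropic structure of rank `k`: a `g`-isotropic smooth subbundle of rank `k`
of the big tangent bundle. (Isotropy forces `k ≤ dim V` when `M` is non-empty.) -/
structure IsBigIsotropic {V : Type*} [NormedAddCommGroup V] [NormedSpace ℝ V]
    {M : Type*} [TopologicalSpace M] [ChartedSpace V M] [IsManifold 𝓘(ℝ, V) ∞ M]
    (k : ℕ) (E : ∀ x : M, Submodule ℝ (BigTangent V x)) : Prop where
  subbundle : IsSmoothBigSubbundle k E
  isotropic : ∀ x, E x ≤ bigOrthogonal E x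

/-- Integrability: the space of global smooth sections of `E` is closed under
the Courant bracket. -/
def IsCourantClosed {V : Type*} [NormedAddCommGroup V] [NormedSpace ℝ V]
    {M : Type*} [TopologicalSpace M] [ChartedSpace V M] [IsManifold 𝓘(ℝ, V) ∞ M]
    (E : ∀ x : M, Submodule ℝ (BigTangent V x)) : Prop :=
  ∀ σ τ : ∀ x : M, BigTangent V x,
    IsSmoothBigSectionOn σ Set.univ → IsSmoothBigSectionOn τ Set.univ →
    (∀ x, σ x ∈ E x) → (∀ x, τ x ∈ E x) → ∀ x, courantBracket σ τ x ∈ E x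

/-- The pullback field `f^*E` along a smooth map `f : N → M`. -/
def pullbackField {V W : Type*} [NormedAddCommGroup V] [NormedSpace ℝ V]
    [NormedAddCommGroup W] [NormedSpace ℝ W]
    {M : Type*} [TopologicalSpace M] [ChartedSpace V M]
    {N : Type*} [TopologicalSpace N] [ChartedSpace W N]
    (f : N → M) (E : ∀ y : M, Submodule ℝ (BigTangent V y)) (x : N) :
    Submodule ℝ (BigTangent W x) :=
  bigPullback (mfderiv 𝓘(ℝ, W) 𝓘(ℝ, V) f x) (E (f x))

/-- The push-forward `f_*(E_x) ⊆ T_{f(x)}M ⊕ T_{f(x)}^*M` along a smooth map `f : N → M`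
at the point `x` of `N`. -/
def pushforwardAt {V W : Type*} [NormedAddCommGroup V] [NormedSpace ℝ V]
    [NormedAddCommGroup W] [NormedSpace ℝ W]
    {M : Type*} [TopologicalSpace M] [ChartedSpace V M]
    {N : Type*} [TopologicalSpace N] [ChartedSpace W N]
    (f : N → M) (E : ∀ x : N, Submodule ℝ (BigTangent W x)) (x : N) :
    Submodule ℝ (BigTangent V (f x)) :=
  bigPushforward (mfderiv 𝓘(ℝ, W) 𝓘(ℝ, V) f x) (E x)

/-- `E ∩ (TN ⊕ T^*_N M)` at the point `x` of `N`, for a map `ι : N → M`. -/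
def tangentialPart {V W : Type*} [NormedAddCommGroup V] [NormedSpace ℝ V]
    [NormedAddCommGroup W] [NormedSpace ℝ W]
    {M : Type*} [TopologicalSpace M] [ChartedSpace V M]
    {N : Type*} [TopologicalSpace N] [ChartedSpace W N]
    (ι : N → M) (E : ∀ y : M, Submodule ℝ (BigTangent V y)) (x : N) :
    Submodule ℝ (BigTangent V (ι x)) :=
  E (ι x) ⊓ Submodule.prod
    (LinearMap.range (mfderiv 𝓘(ℝ, W) 𝓘(ℝ, V) ι x).toLinearMap) ⊤

/-- Reducibility: with `T𝓕 = ker dπ` and `ann TN` the covectors vanishing on the image of `dι`,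
the projection `E ∩ (T𝓕 ⊕ ann TN) → T𝓕` is surjective at every point of `N`. -/
def IsReducible {V W Z : Type*} [NormedAddCommGroup V] [NormedSpace ℝ V]
    [NormedAddCommGroup W] [NormedSpace ℝ W] [NormedAddCommGroup Z] [NormedSpace ℝ Z]
    {M : Type*} [TopologicalSpace M] [ChartedSpace V M]
    {N : Type*} [TopologicalSpace N] [ChartedSpace W N]
    {Q : Type*} [TopologicalSpace Q] [ChartedSpace Z Q]
    (ι : N → M) (π : N → Q) (E : ∀ y : M, Submodule ℝ (BigTangent V y)) : Prop :=
  ∀ (x : N) (Y : TangentSpace 𝓘(ℝ, W) x), mfderiv 𝓘(ℝ, W) 𝓘(ℝ, Z) π x Y = 0 →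
    ∃ α : TangentSpace 𝓘(ℝ, V) (ι x) →L[ℝ] ℝ,
      (∀ X : TangentSpace 𝓘(ℝ, W) x, α (mfderiv 𝓘(ℝ, W) 𝓘(ℝ, V) ι x X) = 0) ∧
      (mfderiv 𝓘(ℝ, W) 𝓘(ℝ, V) ι x Y, α) ∈ E (ι x)

end

/-! Write `L` for `ι^*E`. The dimension of `L x` is determined by those of `E`, `E ∩ (TN ⊕ T^*_N M)`
and `E' ∩ (TN ⊕ T^*_N M)` (`finrank_bigPullback_of_injective`), so `L` has constant rank. Since `E ∩
(TN ⊕ T^*_N M)` has constant dimension too, `L` has smooth local frames, and its local sections are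
`ι`-related to local sections of `E` (`exists_related_lift`). The Courant bracket respects
relatedness (`BigRelated.flatBracket`) and is local, so `L` is integrable
(`exists_isChartIntegrable_pullbackField`).

Reducibility says exactly that `(Y, 0)` lies in `L` for every `Y` in `ker dπ`. As `L` is isotropic,
its covectors annihilate `ker dπ`, hence descend, and `π^* π_* L = L`
(`bigPullback_bigPushforward`). In a chart where `π` is a linear projection `q`, take a constant
vector `κ` in `ker q`. The bracket of `(κ, 0)` with a section of `L` is the derivative of that
section along `κ`, so this derivative stays in `L`. For a frame normalised by a constant linear map
it must vanish, and `L` is locally constant along the fibres (`eventually_eq_of_bracket_closed`).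
Connectedness of the fibres then makes `π_* L` depend on the base point only (`exists_reduced`).

The field on `Q` thus obtained pulls back to `L`. Transporting frames of `L` along local sections of
`π` shows that it is a smooth subbundle (`isSmoothBigSubbundle_of_pullbackField_eq`). Lifting its
sections to related sections of `L` shows that it is integrable
(`isCourantClosed_of_pullbackField_eq`). Uniqueness follows from surjectivity of `π`. -/

noncomputable section

open Filter Topology

/-! ### Maps between normed spaces that are smooth near a point. -/

section SmoothNear

variable {V W G H F : Type*} [NormedAddCommGroup V] [NormedSpace ℝ V]
  [NormedAddCommGroup W] [NormedSpace ℝ W]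
  [NormedAddCommGroup G] [NormedSpace ℝ G] [NormedAddCommGroup H] [NormedSpace ℝ H]
  [NormedAddCommGroup F] [NormedSpace ℝ F]

/-- `f` is smooth in a neighbourhood of `v`. -/
def SmoothNear (f : V → G) (v : V) : Prop := ∀ᶠ w in 𝓝 v, ContDiffAt ℝ ∞ f w

namespace SmoothNear

variable {v : V}

theorem contDiffAt {f : V → G} (h : SmoothNear f v) : ContDiffAt ℝ ∞ f v := h.self_of_nhds

theorem continuousAt {f : V → G} (h : SmoothNear f v) : ContinuousAt f v :=
  h.contDiffAt.continuousAt

theorem differentiableAt {f : V → G} (h : SmoothNear f v) : DifferentiableAt ℝ f v :=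
  h.contDiffAt.differentiableAt (by simp)

/-- This is the advantage over `ContDiffAt ℝ ∞` at a single point, where the neighbourhood may
shrink with the order of differentiability. -/
theorem eventually {f : V → G} (h : SmoothNear f v) : ∀ᶠ w in 𝓝 v, SmoothNear f w :=
  eventually_eventually_nhds.2 h

theorem of_contDiff {f : V → G} (h : ContDiff ℝ ∞ f) : SmoothNear f v :=
  Eventually.of_forall fun _ => h.contDiffAt

theorem const (c : G) : SmoothNear (fun _ : V => c) v := of_contDiff contDiff_const

theorem clm (f : V →L[ℝ] G) : SmoothNear f v := of_contDiff f.contDiff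

theorem congr {f g : V → G} (h : SmoothNear f v) (hfg : g =ᶠ[𝓝 v] f) : SmoothNear g v := by
  filter_upwards [h, hfg.eventually_nhds] with w h1 h2 using h1.congr_of_eventuallyEq h2

theorem comp {g : W → G} {f : V → W} (hg : SmoothNear g (f v)) (hf : SmoothNear f v) :
    SmoothNear (fun x => g (f x)) v := by
  filter_upwards [hf.continuousAt.eventually hg, hf] with w h1 h2 using h1.comp w h2

theorem prodMk {f : V → G} {g : V → H} (hf : SmoothNear f v) (hg : SmoothNear g v) :
    SmoothNear (fun x => (f x, g x)) v := by
  filter_upwards [hf, hg] with w h1 h2 using h1.prodMk h2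

theorem fst {f : V → G × H} (hf : SmoothNear f v) : SmoothNear (fun x => (f x).1) v := by
  filter_upwards [hf] with w h using h.fst

theorem snd {f : V → G × H} (hf : SmoothNear f v) : SmoothNear (fun x => (f x).2) v := by
  filter_upwards [hf] with w h using h.snd

theorem add {f g : V → G} (hf : SmoothNear f v) (hg : SmoothNear g v) :
    SmoothNear (fun x => f x + g x) v := by
  filter_upwards [hf, hg] with w h1 h2 using h1.add h2

theorem sub {f g : V → G} (hf : SmoothNear f v) (hg : SmoothNear g v) :
    SmoothNear (fun x => f x - g x) v := by
  filter_upwards [hf, hg] with w h1 h2 using h1.sub h2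

theorem clm_comp {f : V → G →L[ℝ] H} {g : V → F →L[ℝ] G} (hf : SmoothNear f v)
    (hg : SmoothNear g v) : SmoothNear (fun x => (f x).comp (g x)) v := by
  filter_upwards [hf, hg] with w h1 h2 using h1.clm_comp h2

theorem clm_apply {f : V → G →L[ℝ] H} {g : V → G} (hf : SmoothNear f v)
    (hg : SmoothNear g v) : SmoothNear (fun x => f x (g x)) v := by
  filter_upwards [hf, hg] with w h1 h2 using h1.clm_apply h2

theorem clm_prod {f : V → F →L[ℝ] G} {g : V → F →L[ℝ] H} (hf : SmoothNear f v)
    (hg : SmoothNear g v) : SmoothNear (fun x => (f x).prod (g x)) v := by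
  refine (((const (.inl ℝ G H)).clm_comp hf).add ((const (.inr ℝ G H)).clm_comp hg)).congr ?_
  exact Eventually.of_forall fun x => by ext c <;> simp

theorem fderiv {f : V → G} (hf : SmoothNear f v) : SmoothNear (fderiv ℝ f) v := by
  filter_upwards [hf] with w h using h.fderiv_right (m := ∞) (by simp)

theorem inverse [CompleteSpace F] {f : V → F →L[ℝ] G} (hf : SmoothNear f v)
    (hv : (f v).IsInvertible) : SmoothNear (fun x => (f x).inverse) v := by
  obtain ⟨e, he⟩ := hv
  have h1 : ∀ᶠ w in 𝓝 v, f w ∈ Set.range ((↑) : (F ≃L[ℝ] G) → F →L[ℝ] G) :=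
    hf.continuousAt.eventually (by rw [← he]; exact e.nhds)
  filter_upwards [h1, hf] with w ⟨e', he'⟩ h2
  have := contDiffAt_map_inverse (𝕜 := ℝ) (n := ∞) e'
  rw [he'] at this
  exact this.comp w h2

theorem eventually_isInvertible [CompleteSpace F] {f : V → F →L[ℝ] G} (hf : SmoothNear f v)
    (hv : (f v).IsInvertible) : ∀ᶠ w in 𝓝 v, (f w).IsInvertible := by
  obtain ⟨e, he⟩ := hv
  exact hf.continuousAt.eventually (by rw [← he]; exact e.nhds)

theorem sum_smulRight {k : ℕ} {f : Fin k → V → G} (hf : ∀ i, SmoothNear (f i) v) :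
    SmoothNear (fun w => ∑ i, (ContinuousLinearMap.proj (R := ℝ)
      (φ := fun _ : Fin k => ℝ) i).smulRight (f i w)) v := by
  filter_upwards [eventually_all.2 hf] with w hw
  refine ContDiffAt.sum fun i _ => ?_
  exact (ContinuousLinearMap.contDiff (ContinuousLinearMap.smulRightL ℝ (Fin k → ℝ) G
    (ContinuousLinearMap.proj i))).contDiffAt.comp w (hw i)

end SmoothNear

end SmoothNear

/-! ### Kernels and ranges of smooth families of linear maps of constant rank. -/

section ConstantRank

variable {V G F : Type*} [NormedAddCommGroup V] [NormedSpace ℝ V]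
  [NormedAddCommGroup G] [NormedSpace ℝ G] [FiniteDimensional ℝ G]
  [NormedAddCommGroup F] [NormedSpace ℝ F] [FiniteDimensional ℝ F] {v : V}

theorem exists_pseudoinverse (A : F →L[ℝ] G) : ∃ P : G →L[ℝ] F, ∀ c, A (P (A c)) = A c := by
  obtain ⟨s, hs⟩ := A.toLinearMap.rangeRestrict.exists_rightInverse_of_surjective
    A.toLinearMap.range_rangeRestrict
  obtain ⟨p, hp⟩ := (LinearMap.range A.toLinearMap).subtype.exists_leftInverse_of_injective
    (Submodule.ker_subtype _)
  refine ⟨LinearMap.toContinuousLinearMap (s.comp p), fun c => ?_⟩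
  have h1 : p (A c) = A.toLinearMap.rangeRestrict c :=
    LinearMap.congr_fun hp (A.toLinearMap.rangeRestrict c)
  have h2 := LinearMap.congr_fun hs (A.toLinearMap.rangeRestrict c)
  have h3 := congrArg Subtype.val h2
  simp only [LinearMap.coe_toContinuousLinearMap', LinearMap.comp_apply]
  rw [h1]
  exact h3

/-- The kernels of a smooth family of linear maps of constant rank are the ranges of a smooth
family of linear maps. -/
theorem exists_smooth_range_eq_ker {A : V → F →L[ℝ] G} (hA : SmoothNear A v) {d : ℕ}
    (hd : ∀ᶠ w in 𝓝 v, Module.finrank ℝ (LinearMap.ker (A w).toLinearMap) = d) :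
    ∃ K : V → F →L[ℝ] F, SmoothNear K v ∧
      ∀ᶠ w in 𝓝 v, LinearMap.range (K w).toLinearMap = LinearMap.ker (A w).toLinearMap := by
  obtain ⟨P, hP⟩ := exists_pseudoinverse (A v)
  let Q : F →L[ℝ] F := ContinuousLinearMap.id ℝ F - P.comp (A v)
  -- `Q` maps into `ker (A v)`, and `D v` is the identity, so `D w` is invertible nearby. On `ker (A
  -- w)` the maps `D w` and `Q` agree, so `(D w)⁻¹ Q` fixes this kernel pointwise; its rank is too
  -- small for its range to be larger.
  let D : V → F →L[ℝ] F := fun w => P.comp (A w) + Q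
  have hD : SmoothNear D v := ((SmoothNear.const P).clm_comp hA).add (SmoothNear.const Q)
  have hDv : (D v).IsInvertible :=
    ⟨ContinuousLinearEquiv.refl ℝ F, by ext c; simp [D, Q]⟩
  have hQ : LinearMap.range Q.toLinearMap ≤ LinearMap.ker (A v).toLinearMap := by
    rintro _ ⟨c, rfl⟩
    simp [Q, hP]
  refine ⟨fun w => (D w).inverse.comp Q, (hD.inverse hDv).clm_comp (SmoothNear.const Q), ?_⟩
  have hdv := hd.self_of_nhds
  filter_upwards [hD.eventually_isInvertible hDv, hd] with w hw hdw
  symm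
  apply Submodule.eq_of_le_of_finrank_le
  · intro c hc
    have hc' : A w c = 0 := hc
    refine ⟨c, ?_⟩
    have : Q c = D w c := by simp [D, hc']
    change (D w).inverse (Q c) = c
    rw [this]
    exact hw.inverse_apply_self c
  · have h1 : LinearMap.range ((D w).inverse.comp Q).toLinearMap =
        (LinearMap.range Q.toLinearMap).map (D w).inverse.toLinearMap := by
      rw [← LinearMap.range_comp]; rfl
    rw [h1, hdw, ← hdv]
    exact (Submodule.finrank_map_le _ _).trans (Submodule.finrank_mono hQ)

/-- The ranges of a smooth family of linear maps of constant rank have a smooth frame, which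
lifts and can be normalised by a constant linear map. -/
theorem exists_smooth_frame_range {A : V → F →L[ℝ] G} (hA : SmoothNear A v) {r : ℕ}
    (hr : ∀ᶠ w in 𝓝 v, Module.finrank ℝ (LinearMap.range (A w).toLinearMap) = r) :
    ∃ (B : G →L[ℝ] (Fin r → ℝ)) (C : V → (Fin r → ℝ) →L[ℝ] F), SmoothNear C v ∧
      ∀ᶠ w in 𝓝 v, (∀ c, B (A w (C w c)) = c) ∧
        LinearMap.range ((A w).comp (C w)).toLinearMap = LinearMap.range (A w).toLinearMap := by
  obtain ⟨s, hs⟩ := (A v).toLinearMap.rangeRestrict.exists_rightInverse_of_surjective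
    (A v).toLinearMap.range_rangeRestrict
  obtain ⟨p, hp⟩ := (LinearMap.range (A v).toLinearMap).subtype.exists_leftInverse_of_injective
    (Submodule.ker_subtype _)
  let e : (Fin r → ℝ) ≃ₗ[ℝ] LinearMap.range (A v).toLinearMap :=
    LinearEquiv.ofFinrankEq _ _ (by rw [hr.self_of_nhds]; simp)
  let J : (Fin r → ℝ) →L[ℝ] F := LinearMap.toContinuousLinearMap (s.comp e.toLinearMap)
  let B : G →L[ℝ] (Fin r → ℝ) := LinearMap.toContinuousLinearMap (e.symm.toLinearMap.comp p)
  -- `J` lifts a basis of the range of `A v`, and `B` extends the coordinates in that basis to `G`.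
  -- Thus `D v` is the identity, and correcting `J` by `(D w)⁻¹` keeps the coordinates under the
  -- fixed map `B` constant.
  let D : V → (Fin r → ℝ) →L[ℝ] (Fin r → ℝ) := fun w => B.comp ((A w).comp J)
  have hD : SmoothNear D v :=
    (SmoothNear.const B).clm_comp (hA.clm_comp (SmoothNear.const J))
  have hDv : (D v).IsInvertible := by
    refine ⟨ContinuousLinearEquiv.refl ℝ _, ?_⟩
    refine ContinuousLinearMap.ext fun c => ?_
    have h2 : A v (J c) = (e c : G) := congrArg Subtype.val (LinearMap.congr_fun hs (e c))
    have h3 : p (e c : G) = e c := LinearMap.congr_fun hp (e c)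
    change c = e.symm (p (A v (J c)))
    rw [h2, h3, e.symm_apply_apply]
  refine ⟨B, fun w => J.comp (D w).inverse, (SmoothNear.const J).clm_comp (hD.inverse hDv), ?_⟩
  filter_upwards [hD.eventually_isInvertible hDv, hr] with w hw hrw
  have h1 : ∀ c, B (A w (J ((D w).inverse c))) = c := fun c => hw.self_apply_inverse c
  refine ⟨h1, Submodule.eq_of_le_of_finrank_eq (LinearMap.range_comp_le_range _ _) ?_⟩
  rw [hrw, LinearMap.finrank_range_of_inj]
  · simp
  · intro c c' h
    have := congrArg B h
    simpa [h1] using this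

end ConstantRank

/-! ### Pullback and push-forward of subspaces of `W ⊕ W*`. -/

section BigLinearAlgebra

variable {V W U : Type*}
  [AddCommGroup V] [Module ℝ V] [TopologicalSpace V] [IsTopologicalAddGroup V]
  [ContinuousSMul ℝ V]
  [AddCommGroup W] [Module ℝ W] [TopologicalSpace W] [IsTopologicalAddGroup W]
  [ContinuousSMul ℝ W]
  [AddCommGroup U] [Module ℝ U] [TopologicalSpace U] [IsTopologicalAddGroup U]
  [ContinuousSMul ℝ U]

theorem bigPullback_comp (l : W →L[ℝ] V) (m : U →L[ℝ] W) (E : Submodule ℝ (Big V)) :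
    bigPullback (l.comp m) E = bigPullback m (bigPullback l E) := by
  ext u
  constructor
  · rintro ⟨α, h1, h2⟩
    exact ⟨α.comp l, ⟨α, h1, rfl⟩, h2⟩
  · rintro ⟨_, ⟨α, h1, rfl⟩, h2⟩
    exact ⟨α, h1, h2⟩

theorem bigPullback_id (E : Submodule ℝ (Big V)) :
    bigPullback (ContinuousLinearMap.id ℝ V) E = E := by
  ext u
  constructor
  · rintro ⟨α, h1, h2⟩
    have : u.2 = α := h2
    exact (show u = (u.1, α) by rw [← this]) ▸ h1
  · intro h
    exact ⟨u.2, h, rfl⟩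

/-- The covector of an element of a pullback by a surjective map is unique. -/
theorem mem_of_mem_bigPullback {l : W →L[ℝ] V} (hl : Function.Surjective l)
    {E : Submodule ℝ (Big V)} {X : W} {α : V →L[ℝ] ℝ} (h : (X, α.comp l) ∈ bigPullback l E) :
    (l X, α) ∈ E := by
  obtain ⟨β, h1, h2⟩ := h
  have : α = β := by
    ext y
    obtain ⟨x, rfl⟩ := hl y
    exact DFunLike.congr_fun h2 x
  rwa [this]

/-- A surjective linear map induces on isotropic subspaces containing its kernel the relation
`l^* l_* L = L`. -/
theorem bigPullback_bigPushforward {l : W →L[ℝ] V} {r : V →L[ℝ] W} (hr : ∀ y, l (r y) = y)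
    {L : Submodule ℝ (Big W)} (hker : ∀ X, l X = 0 → ((X, 0) : Big W) ∈ L)
    (hiso : L ≤ (bigMetric W).orthogonal L) :
    bigPullback l (bigPushforward l L) = L := by
  ext u
  constructor
  · rintro ⟨α, ⟨X, h1, h2⟩, h3⟩
    have h4 : l (u.1 - X) = 0 := by rw [map_sub, sub_eq_zero]; exact h2
    have := L.add_mem h1 (hker _ h4)
    simpa [← h3] using this
  · intro hu
    -- Pairing with `(Y, 0)`, which lies in `L`, shows that covectors of `L` vanish on `ker l`; they
    -- therefore factor through `l`, by way of the section `r`.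
    have hann : ∀ Y, l Y = 0 → u.2 Y = 0 := by
      intro Y hY
      have := hiso hu (Y, 0) (hker Y hY)
      simpa [bigMetric] using this
    have h2 : u.2 = (u.2.comp r).comp l := by
      ext x
      have := hann (x - r (l x)) (by rw [map_sub, hr, sub_self])
      rw [map_sub, sub_eq_zero] at this
      simpa using this
    refine ⟨u.2.comp r, ⟨u.1, ?_, rfl⟩, h2⟩
    have : (u.1, (u.2.comp r).comp l) = u := by rw [← h2]
    rw [this]; exact hu

theorem bigPullback_isotropic {l : W →L[ℝ] V} {E : Submodule ℝ (Big V)}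
    (h : E ≤ (bigMetric V).orthogonal E) :
    bigPullback l E ≤ (bigMetric W).orthogonal (bigPullback l E) := by
  rintro u ⟨α, h1, h2⟩ u' ⟨β, h1', h2'⟩
  have := h h1 _ h1'
  simpa [bigMetric, h2, h2'] using this

theorem bigPushforward_isotropic {l : W →L[ℝ] V} {E : Submodule ℝ (Big W)}
    (h : E ≤ (bigMetric W).orthogonal E) :
    bigPushforward l E ≤ (bigMetric V).orthogonal (bigPushforward l E) := by
  rintro u ⟨X, h1, h2⟩ u' ⟨Y, h1', h2'⟩
  have := h h1 _ h1'
  simpa [bigMetric, h2, h2'] using this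

theorem bigMetric_isRefl : (bigMetric V).IsRefl := by
  intro u v h
  have : bigMetric V v u = bigMetric V u v := by simp [bigMetric, add_comm]
  rw [this, h]

theorem bigPushforward_comp (l : W →L[ℝ] V) (m : U →L[ℝ] W) (E : Submodule ℝ (Big U)) :
    bigPushforward (l.comp m) E = bigPushforward l (bigPushforward m E) := by
  ext u
  constructor
  · rintro ⟨X, h1, h2⟩
    exact ⟨m X, ⟨X, h1, rfl⟩, h2⟩
  · rintro ⟨_, ⟨X, h1, rfl⟩, h2⟩
    exact ⟨X, h1, h2⟩

theorem bigPushforward_bigPullback {l : W →L[ℝ] V} {r : V →L[ℝ] W} (hr : ∀ y, l (r y) = y)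
    (E : Submodule ℝ (Big V)) : bigPushforward l (bigPullback l E) = E := by
  have hl : Function.Surjective l := fun y => ⟨r y, hr y⟩
  ext u
  constructor
  · rintro ⟨X, h1, h2⟩
    have := mem_of_mem_bigPullback hl h1
    rwa [← h2] at this
  · intro hu
    exact ⟨r u.1, ⟨u.2, by rwa [hr], rfl⟩, (hr _).symm⟩

/-- A linear map `l` with a section `r` maps `l^*E` onto `E`. -/
theorem map_bigPullback_of_section {l : W →L[ℝ] V} {r : V →L[ℝ] W} (hr : ∀ y, l (r y) = y)
    (E : Submodule ℝ (Big V)) (Φ : Big W →ₗ[ℝ] Big V)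
    (hΦ : ∀ u, Φ u = (l u.1, u.2.comp r)) :
    (bigPullback l E).map Φ = E := by
  ext u
  constructor
  · rintro ⟨w, ⟨α, h1, h2⟩, rfl⟩
    have : w.2.comp r = α := by ext y; rw [h2]; simp [hr]
    rw [hΦ, this]; exact h1
  · intro hu
    refine ⟨(r u.1, u.2.comp l), ⟨u.2, by simpa [hr] using hu, rfl⟩, ?_⟩
    rw [hΦ]
    refine Prod.ext (hr _) ?_
    ext y
    simp [hr]

end BigLinearAlgebra

/-! ### Dimension counts for pullbacks. -/

section Rank

variable {V W : Type*}
  [AddCommGroup V] [Module ℝ V] [TopologicalSpace V] [IsTopologicalAddGroup V]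
  [ContinuousSMul ℝ V] [T2Space V] [FiniteDimensional ℝ V]
  [AddCommGroup W] [Module ℝ W] [TopologicalSpace W] [IsTopologicalAddGroup W]
  [ContinuousSMul ℝ W] [FiniteDimensional ℝ W]

variable (V) in
theorem finrank_dual_clm : Module.finrank ℝ (V →L[ℝ] ℝ) = Module.finrank ℝ V := by
  rw [← LinearMap.toContinuousLinearMap.finrank_eq]
  exact Subspace.dual_finrank_eq

instance : FiniteDimensional ℝ (V →L[ℝ] ℝ) :=
  LinearMap.toContinuousLinearMap.finiteDimensional

variable (V) in
theorem bigMetric_nondegenerate : (bigMetric V).Nondegenerate := by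
  have key : ∀ u : Big V, (∀ v, bigMetric V u v = 0) → u = 0 := by
    intro u hu
    have h2 : u.2 = 0 := by
      ext x
      have := hu (x, 0)
      simpa [bigMetric] using this
    have h1 : u.1 = 0 := by
      rw [← Module.forall_dual_apply_eq_zero_iff ℝ]
      intro φ
      have := hu (0, LinearMap.toContinuousLinearMap φ)
      simpa [bigMetric] using this
    exact Prod.ext h1 h2
  exact ⟨key, fun u hu => key u fun v => bigMetric_isRefl _ _ (hu v)⟩

/-- The dimension of `l^*E`, in terms of the tangential parts of `E` and `E'`. -/
theorem finrank_bigPullback_of_injective {l : W →L[ℝ] V} (hl : Function.Injective l)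
    (E : Submodule ℝ (Big V)) :
    Module.finrank ℝ (bigPullback l E) + (Module.finrank ℝ E + Module.finrank ℝ
      ((bigMetric V).orthogonal E ⊓ (LinearMap.range l.toLinearMap).prod ⊤ :
        Submodule ℝ (Big V))) =
    Module.finrank ℝ (E ⊓ (LinearMap.range l.toLinearMap).prod ⊤ : Submodule ℝ (Big V)) +
      (Module.finrank ℝ W + Module.finrank ℝ V) := by
  set P : Submodule ℝ (Big V) := (LinearMap.range l.toLinearMap).prod ⊤
  let τ : (W × (V →L[ℝ] ℝ)) →ₗ[ℝ] Big V := l.toLinearMap.prodMap LinearMap.id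
  have hτ : Function.Injective τ := Function.Injective.prodMap hl Function.injective_id
  let pre : (V →L[ℝ] ℝ) →ₗ[ℝ] (W →L[ℝ] ℝ) :=
    { toFun := fun α => α.comp l
      map_add' := fun _ _ => rfl
      map_smul' := fun _ _ => rfl }
  -- `l^*E` is the image under `ρ` of `τ⁻¹(E)`, which is isomorphic to `E ∩ P`. The kernel of `ρ` on
  -- it corresponds under `τ` to `E ∩ P^⊥`.
  let ρ : (W × (V →L[ℝ] ℝ)) →ₗ[ℝ] Big W := LinearMap.id.prodMap pre
  have hS : (E.comap τ).map τ = E ⊓ P := by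
    rw [Submodule.map_comap_eq, inf_comm]
    congr 1
    rw [LinearMap.range_prodMap, LinearMap.range_id]
  have h1 : Module.finrank ℝ (E.comap τ) = Module.finrank ℝ (E ⊓ P : Submodule ℝ (Big V)) := by
    rw [← hS]
    exact (LinearEquiv.finrank_eq (Submodule.equivMapOfInjective τ hτ _))
  have h2 : (E.comap τ).map ρ = bigPullback l E := by
    ext u
    constructor
    · rintro ⟨w, hw, rfl⟩
      exact ⟨w.2, hw, rfl⟩
    · rintro ⟨α, h1, h2⟩
      exact ⟨(u.1, α), h1, Prod.ext rfl h2.symm⟩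
  have h3 := LinearMap.finrank_range_add_finrank_ker (K := ℝ) (V := E.comap τ) (V₂ := Big W)
    (ρ.domRestrict (E.comap τ))
  rw [LinearMap.range_domRestrict, h2, h1] at h3
  have hPo : (bigMetric V).orthogonal P = (⊥ : Submodule ℝ V).prod (LinearMap.ker pre) := by
    ext u
    rw [LinearMap.BilinForm.mem_orthogonal_iff]
    constructor
    · intro h
      constructor
      · change u.1 = 0
        rw [← Module.forall_dual_apply_eq_zero_iff ℝ]
        intro φ
        have := h (0, LinearMap.toContinuousLinearMap φ) ⟨Submodule.zero_mem _, trivial⟩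
        simpa [bigMetric] using this
      · ext x
        have := h (l x, 0) ⟨⟨x, rfl⟩, trivial⟩
        change u.2 (l x) = 0
        simpa [bigMetric] using this
    · rintro ⟨hu1, hu2⟩ v ⟨⟨x, hx⟩, -⟩
      have hu1' : u.1 = 0 := hu1
      have := DFunLike.congr_fun (show u.2.comp l = 0 from hu2) x
      have hx' : l x = v.1 := hx
      simp only [ContinuousLinearMap.comp_apply, hx'] at this
      simp [bigMetric, hu1', this]
  have h4 : ((LinearMap.ker ρ ⊓ E.comap τ).map τ) = E ⊓ (bigMetric V).orthogonal P := by
    rw [hPo]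
    ext u
    constructor
    · rintro ⟨w, ⟨hw1, hw2⟩, rfl⟩
      have hw1' : ρ w = 0 := hw1
      refine ⟨hw2, ?_, congrArg Prod.snd hw1'⟩
      have : w.1 = 0 := congrArg Prod.fst hw1'
      change l w.1 = 0
      rw [this, map_zero]
    · rintro ⟨hu, hu1, hu2⟩
      have hu1' : u.1 = 0 := hu1
      have hτu : τ (0, u.2) = u := Prod.ext (by rw [hu1']; exact map_zero l) rfl
      refine ⟨(0, u.2), ⟨Prod.ext rfl hu2, ?_⟩, hτu⟩
      change τ (0, u.2) ∈ E
      rw [hτu]; exact hu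
  have h5 : Module.finrank ℝ (LinearMap.ker (ρ.domRestrict (E.comap τ))) =
      Module.finrank ℝ (E ⊓ (bigMetric V).orthogonal P : Submodule ℝ (Big V)) := by
    rw [← h4, ← LinearEquiv.finrank_eq (Submodule.equivMapOfInjective τ hτ _)]
    have : (LinearMap.ker (ρ.domRestrict (E.comap τ))).map (E.comap τ).subtype =
        LinearMap.ker ρ ⊓ E.comap τ := by
      ext w
      constructor
      · rintro ⟨⟨w, hw⟩, h, rfl⟩
        exact ⟨h, hw⟩
      · rintro ⟨h, hw⟩
        exact ⟨⟨w, hw⟩, h, rfl⟩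
    rw [← this]
    exact LinearEquiv.finrank_eq (Submodule.equivMapOfInjective _ (Submodule.subtype_injective _) _)
  have hnd := bigMetric_nondegenerate V
  -- Since `E'' = E`, the space `E ∩ P^⊥` is the orthogonal of `E' + P`; the dimension formula for a
  -- sum then brings in `E' ∩ P`.
  have h6 : E ⊓ (bigMetric V).orthogonal P =
      (bigMetric V).orthogonal ((bigMetric V).orthogonal E ⊔ P) := by
    apply le_antisymm
    · rintro u ⟨hu1, hu2⟩ v hv
      obtain ⟨a, ha, b, hb, rfl⟩ := Submodule.mem_sup.1 hv
      have h1 := bigMetric_isRefl _ _ (ha u hu1)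
      have h2 := hu2 b hb
      rw [LinearMap.map_add, LinearMap.add_apply]
      rw [show bigMetric V b u = 0 from h2]
      rw [h1, add_zero]
    · intro u hu
      refine ⟨?_, fun v hv => hu v (Submodule.mem_sup_right hv)⟩
      rw [← LinearMap.BilinForm.orthogonal_orthogonal hnd bigMetric_isRefl E]
      exact fun v hv => hu v (Submodule.mem_sup_left hv)
  have hB := finrank_dual_clm V
  have hBV : Module.finrank ℝ (Big V) = Module.finrank ℝ V + Module.finrank ℝ V := by
    rw [Module.finrank_prod, hB]
  have h7 := LinearMap.BilinForm.finrank_orthogonal hnd ((bigMetric V).orthogonal E ⊔ P)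
  have h8 := LinearMap.BilinForm.finrank_orthogonal hnd E
  have h9 := Submodule.finrank_sup_add_finrank_inf_eq ((bigMetric V).orthogonal E) P
  have h10 : Module.finrank ℝ P = Module.finrank ℝ W + Module.finrank ℝ V := by
    have : P = LinearMap.range τ := by rw [LinearMap.range_prodMap, LinearMap.range_id]
    rw [this, LinearMap.finrank_range_of_inj hτ, Module.finrank_prod, hB]
  have h11 := Submodule.finrank_le E
  have h12 := Submodule.finrank_le ((bigMetric V).orthogonal E ⊔ P)
  rw [← h6] at h7
  omega

/-- The dimension of `l^*E` for surjective `l`. -/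
theorem finrank_bigPullback_of_surjective {l : W →L[ℝ] V} (hl : Function.Surjective l)
    (E : Submodule ℝ (Big V)) :
    Module.finrank ℝ (bigPullback l E) + Module.finrank ℝ V =
      Module.finrank ℝ E + Module.finrank ℝ W := by
  obtain ⟨r, hr⟩ := l.toLinearMap.exists_rightInverse_of_surjective (LinearMap.range_eq_top.2 hl)
  have hr' : ∀ y, l (r y) = y := fun y => LinearMap.congr_fun hr y
  let R : V →L[ℝ] W := LinearMap.toContinuousLinearMap r
  let Φ : Big W →ₗ[ℝ] Big V :=
    { toFun := fun u => (l u.1, u.2.comp R)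
      map_add' := fun u v => by simp [ContinuousLinearMap.add_comp]
      map_smul' := fun c u => by simp }
  have h1 := map_bigPullback_of_section (l := l) (r := R) hr' E Φ fun _ => rfl
  have h3 := LinearMap.finrank_range_add_finrank_ker (K := ℝ) (V := bigPullback l E)
    (V₂ := Big V) (Φ.domRestrict (bigPullback l E))
  rw [LinearMap.range_domRestrict, h1] at h3
  -- `Φ` maps `l^*E` onto `E`, and what it kills is `ker l ⊕ 0`.
  have h4 : ((LinearMap.ker (Φ.domRestrict (bigPullback l E))).map
      (bigPullback l E).subtype) =
      (LinearMap.ker l.toLinearMap).map (LinearMap.inl ℝ W (W →L[ℝ] ℝ)) := by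
    ext u
    constructor
    · rintro ⟨⟨u, ⟨α, hu1, hu2⟩⟩, h, rfl⟩
      have h' : Φ u = 0 := h
      refine ⟨u.1, congrArg Prod.fst h', Prod.ext rfl ?_⟩
      have : u.2.comp R = 0 := congrArg Prod.snd h'
      rw [hu2] at this
      have hα : α = 0 := by
        ext y
        have := DFunLike.congr_fun this y
        simpa [R, hr'] using this
      change 0 = u.2
      rw [hu2, hα]; rfl
    · rintro ⟨X, hX, rfl⟩
      have hX' : l X = 0 := hX
      refine ⟨⟨(X, 0), ⟨0, ?_, by simp⟩⟩, Prod.ext hX' (by simp [Φ]), rfl⟩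
      simp only [hX']; exact E.zero_mem
  have h5 := LinearMap.finrank_range_add_finrank_ker l.toLinearMap
  rw [LinearMap.range_eq_top.2 hl, finrank_top] at h5
  have h6 := congrArg (fun S : Submodule ℝ (Big W) => Module.finrank ℝ S) h4
  rw [← LinearEquiv.finrank_eq (Submodule.equivMapOfInjective _ (Submodule.subtype_injective _) _),
    ← LinearEquiv.finrank_eq (Submodule.equivMapOfInjective _ LinearMap.inl_injective _)] at h6
  omega

end Rank

/-! ### Counting tangential elements through a parametrisation. -/

section

variable {V W F : Type*} [AddCommGroup V] [Module ℝ V] [TopologicalSpace V]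
  [AddCommGroup W] [Module ℝ W] [TopologicalSpace W]
  [AddCommGroup F] [Module ℝ F]

/-- The dimension of the space of pairs `(X, c)` with `(l X, ·) = A c`, for a parametrisation
`A` of `E`. -/
theorem finrank_ker_of_range_eq {l : W →L[ℝ] V} (hl : Function.Injective l) {A : F →ₗ[ℝ] Big V}
    (hA : Function.Injective A) {T : (W × F) →ₗ[ℝ] V} (hT : ∀ x, T x = l x.1 - (A x.2).1) :
    Module.finrank ℝ (LinearMap.ker T) = Module.finrank ℝ
      (LinearMap.range A ⊓ (LinearMap.range l.toLinearMap).prod ⊤ : Submodule ℝ (Big V)) := by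
  have h1 : (LinearMap.ker T).map (A.comp (LinearMap.snd ℝ W F)) =
      LinearMap.range A ⊓ (LinearMap.range l.toLinearMap).prod ⊤ := by
    ext u
    constructor
    · rintro ⟨x, hx, rfl⟩
      have hx' : T x = 0 := hx
      rw [hT, sub_eq_zero] at hx'
      exact ⟨⟨x.2, rfl⟩, ⟨x.1, hx'⟩, trivial⟩
    · rintro ⟨⟨c, rfl⟩, ⟨X, hX⟩, -⟩
      refine ⟨(X, c), ?_, rfl⟩
      change T (X, c) = 0
      rw [hT, sub_eq_zero]; exact hX
  rw [← h1, ← LinearMap.range_domRestrict, LinearMap.finrank_range_of_inj]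
  rintro ⟨x, hx⟩ ⟨y, hy⟩ h
  have hx' : T x = 0 := hx
  have hy' : T y = 0 := hy
  rw [hT, sub_eq_zero] at hx' hy'
  have h2 : x.2 = y.2 := hA h
  have h3 : x.1 = y.1 := hl (by rw [hx', hy', h2])
  exact Subtype.ext (Prod.ext h3 h2)

end

/-! ### The Courant bracket on a normed space and its naturality. -/

section FlatBracket

variable {V W : Type*} [NormedAddCommGroup V] [NormedSpace ℝ V]
  [NormedAddCommGroup W] [NormedSpace ℝ W]

/-- The Courant bracket on a normed space. -/
def flatBracket (s t : V → Big V) (v : V) : Big V :=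
  (lieBracket ℝ (fun w => (s w).1) (fun w => (t w).1) v,
    (fderiv ℝ (fun w => (t w).2) v (s v).1 + (t v).2.comp (fderiv ℝ (fun w => (s w).1) v))
      - (fderiv ℝ (fun w => (s w).2) v (t v).1 + (s v).2.comp (fderiv ℝ (fun w => (t w).1) v))
      + (1 / 2 : ℝ) • fderiv ℝ (fun w => (s w).2 (t w).1 - (t w).2 (s w).1) v)

/-- `s` and `S` are related by `f` at `u`. -/
def BigRelated (f : W → V) (s : W → Big W) (S : V → Big V) (u : W) : Prop :=
  (S (f u)).1 = fderiv ℝ f u (s u).1 ∧ (s u).2 = (S (f u)).2.comp (fderiv ℝ f u)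

theorem flatBracket_congr {s s' t t' : V → Big V} {v : V} (hs : s =ᶠ[𝓝 v] s')
    (ht : t =ᶠ[𝓝 v] t') : flatBracket s t v = flatBracket s' t' v := by
  have h1 : (fun w => (s w).1) =ᶠ[𝓝 v] fun w => (s' w).1 := hs.fun_comp Prod.fst
  have h2 : (fun w => (s w).2) =ᶠ[𝓝 v] fun w => (s' w).2 := hs.fun_comp Prod.snd
  have h3 : (fun w => (t w).1) =ᶠ[𝓝 v] fun w => (t' w).1 := ht.fun_comp Prod.fst
  have h4 : (fun w => (t w).2) =ᶠ[𝓝 v] fun w => (t' w).2 := ht.fun_comp Prod.snd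
  have h5 : (fun w => (s w).2 (t w).1 - (t w).2 (s w).1) =ᶠ[𝓝 v]
      fun w => (s' w).2 (t' w).1 - (t' w).2 (s' w).1 := by
    filter_upwards [hs, ht] with w hw1 hw2 using by rw [hw1, hw2]
  unfold flatBracket
  rw [h1.lieBracket_vectorField_eq h3, h1.fderiv_eq, h2.fderiv_eq, h3.fderiv_eq, h4.fderiv_eq,
    h5.fderiv_eq, hs.eq_of_nhds, ht.eq_of_nhds]

/-- The bracket is natural with respect to smooth maps. -/
theorem BigRelated.flatBracket {f : W → V} {s t : W → Big W} {S T : V → Big V} {u : W}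
    (hf : ContDiffAt ℝ ∞ f u) (hs : DifferentiableAt ℝ s u) (ht : DifferentiableAt ℝ t u)
    (hS : DifferentiableAt ℝ S (f u)) (hT : DifferentiableAt ℝ T (f u))
    (hsS : ∀ᶠ w in 𝓝 u, BigRelated f s S w) (htT : ∀ᶠ w in 𝓝 u, BigRelated f t T w) :
    BigRelated f (flatBracket s t) (flatBracket S T) u := by
  have hfd : DifferentiableAt ℝ f u := hf.differentiableAt (by simp)
  have hfd2 : DifferentiableAt ℝ (fderiv ℝ f) u :=
    (hf.fderiv_right (m := ∞) (by simp)).differentiableAt (by simp)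
  have hsymm : IsSymmSndFDerivAt ℝ f u := hf.isSymmSndFDerivAt (by
    rw [minSmoothness_of_isRCLikeNormedField]; exact WithTop.coe_le_coe.2 le_top)
  -- `vec` and `cov` differentiate the two relatedness identities. Each produces a term in the
  -- second derivative of `f`; in the brackets these terms cancel by the symmetry `hsymm`.
  have vec : ∀ {s : W → Big W} {S : V → Big V}, DifferentiableAt ℝ s u →
      DifferentiableAt ℝ S (f u) → (∀ᶠ w in 𝓝 u, BigRelated f s S w) → ∀ Y,
      fderiv ℝ (fun w => (S w).1) (f u) (fderiv ℝ f u Y) =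
        fderiv ℝ (fderiv ℝ f) u Y (s u).1 + fderiv ℝ f u (fderiv ℝ (fun w => (s w).1) u Y) := by
    intro s S hs hS h Y
    have e1 : (fun w => (S (f w)).1) =ᶠ[𝓝 u] fun w => fderiv ℝ f w (s w).1 :=
      h.mono fun w hw => hw.1
    have h1 : HasFDerivAt (fun w => (S (f w)).1)
        ((fderiv ℝ (fun w => (S w).1) (f u)).comp (fderiv ℝ f u)) u :=
      HasFDerivAt.comp u (f := f) (g := fun w => (S w).1) hS.fst.hasFDerivAt hfd.hasFDerivAt
    have h2 := hfd2.hasFDerivAt.clm_apply hs.fst.hasFDerivAt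
    have := DFunLike.congr_fun (h1.unique (h2.congr_of_eventuallyEq e1)) Y
    simpa [add_comm] using this
  have cov : ∀ {s : W → Big W} {S : V → Big V}, DifferentiableAt ℝ s u →
      DifferentiableAt ℝ S (f u) → (∀ᶠ w in 𝓝 u, BigRelated f s S w) → ∀ X Y,
      fderiv ℝ (fun w => (s w).2) u X Y =
        fderiv ℝ (fun w => (S w).2) (f u) (fderiv ℝ f u X) (fderiv ℝ f u Y) +
          (S (f u)).2 (fderiv ℝ (fderiv ℝ f) u X Y) := by
    intro s S hs hS h X Y
    have e1 : (fun w => (s w).2) =ᶠ[𝓝 u] fun w => (S (f w)).2.comp (fderiv ℝ f w) :=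
      h.mono fun w hw => hw.2
    have h1 : HasFDerivAt (fun w => (S (f w)).2)
        ((fderiv ℝ (fun w => (S w).2) (f u)).comp (fderiv ℝ f u)) u :=
      HasFDerivAt.comp u (f := f) (g := fun w => (S w).2) hS.snd.hasFDerivAt hfd.hasFDerivAt
    have h2 := h1.clm_comp hfd2.hasFDerivAt
    have := hs.snd.hasFDerivAt.unique (h2.congr_of_eventuallyEq e1)
    have := DFunLike.congr_fun (DFunLike.congr_fun this X) Y
    simpa [add_comm] using this
  have hsu := hsS.self_of_nhds
  have htu := htT.self_of_nhds
  have fn : fderiv ℝ (fun w => (s w).2 (t w).1 - (t w).2 (s w).1) u =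
      (fderiv ℝ (fun v => (S v).2 (T v).1 - (T v).2 (S v).1) (f u)).comp (fderiv ℝ f u) := by
    have e1 : (fun w => (s w).2 (t w).1 - (t w).2 (s w).1) =ᶠ[𝓝 u]
        (fun v => (S v).2 (T v).1 - (T v).2 (S v).1) ∘ f := by
      filter_upwards [hsS, htT] with w h1 h2
      simp [h1.1, h1.2, h2.1, h2.2]
    rw [e1.fderiv_eq]
    exact fderiv_comp u ((hS.snd.clm_apply hT.fst).sub (hT.snd.clm_apply hS.fst)) hfd
  constructor
  · simp only [_root_.flatBracket, lieBracket_eq]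
    rw [hsu.1, htu.1, vec hs hS hsS, vec ht hT htT, hsymm (s u).1 (t u).1, map_sub]
    abel
  · refine ContinuousLinearMap.ext fun Y => ?_
    simp only [_root_.flatBracket, fn, _root_.add_apply,
      _root_.sub_apply, ContinuousLinearMap.comp_apply,
      _root_.smul_apply]
    rw [cov hs hS hsS, cov ht hT htT, vec hs hS hsS, vec ht hT htT, hsu.2, htu.2, hsu.1, htu.1,
      hsymm Y (s u).1, hsymm Y (t u).1]
    simp only [ContinuousLinearMap.comp_apply, map_add]
    abel

/-- The bracket of a constant vector field with a section whose covector part vanishes on it. -/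
theorem flatBracket_const {κ : V} {t : V → Big V} {v : V}
    (ht : DifferentiableAt ℝ t v) (hκ : ∀ᶠ w in 𝓝 v, (t w).2 κ = 0) :
    flatBracket (fun _ => (κ, 0)) t v = fderiv ℝ t v κ := by
  have e1 : (fun w => (t w).2 κ) =ᶠ[𝓝 v] fun _ => 0 := hκ
  -- Apart from the derivative of `t` along `κ`, the bracket contains only the exact term `-(1/2)
  -- d(t.2 κ)`, which vanishes by `hκ`.
  have h1 : fderiv ℝ (fun w => -((t w).2 κ)) v = 0 := by
    rw [fderiv_fun_neg, e1.fderiv_eq]; simp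
  have h2 : fderiv ℝ t v = (fderiv ℝ (fun w => (t w).1) v).prod (fderiv ℝ (fun w => (t w).2) v) :=
    ht.fst.fderiv_prodMk ht.snd
  rw [h2]
  simp [flatBracket, lieBracket_eq, h1]

end FlatBracket

/-! ### Smooth frames of pullbacks, and lifts to related sections. -/

section Lift

section

variable {V W F : Type*} [NormedAddCommGroup V] [NormedSpace ℝ V]
  [NormedAddCommGroup W] [NormedSpace ℝ W] [NormedAddCommGroup F] [NormedSpace ℝ F]

/-- Serves two purposes: with `j` an immersion and `ρ` a retraction it gives injectivity of `dj`;
with `j` a local section of a submersion `ρ` it gives a right inverse of `dρ`. -/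
theorem eventually_fderiv_leftInverse {j : W → V} {ρ : V → W} {u : W} (hj : SmoothNear j u)
    (hρ : SmoothNear ρ (j u)) (hρj : ∀ᶠ w in 𝓝 u, ρ (j w) = w) :
    ∀ᶠ w in 𝓝 u, ∀ X, fderiv ℝ ρ (j w) (fderiv ℝ j w X) = X := by
  filter_upwards [hj, hj.continuousAt.eventually hρ, hρj.eventually_nhds] with w h1 h2 h3 X
  have h4 : HasFDerivAt (fun w => ρ (j w)) ((fderiv ℝ ρ (j w)).comp (fderiv ℝ j w)) w :=
    (h2.differentiableAt (by simp)).hasFDerivAt.comp w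
      (h1.differentiableAt (by simp)).hasFDerivAt
  have h5 := (hasFDerivAt_id (𝕜 := ℝ) w).unique (h4.congr_of_eventuallyEq
    (h3.mono fun _ h => h.symm))
  exact (DFunLike.congr_fun h5 X).symm

/-- The map whose kernel consists of the pairs `(X, c)` such that the vector part of `A c`
is `l X`. -/
def tangencyMap (l : W →L[ℝ] V) (A : F →L[ℝ] Big V) : (W × F) →L[ℝ] V :=
  l.comp (.fst ℝ W F) - (ContinuousLinearMap.fst ℝ V (V →L[ℝ] ℝ)).comp (A.comp (.snd ℝ W F))

/-- Precomposition of covectors by a linear map. -/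
def precompMap : (W →L[ℝ] V) →L[ℝ] (V →L[ℝ] ℝ) →L[ℝ] (W →L[ℝ] ℝ) :=
  (ContinuousLinearMap.compL ℝ W V ℝ).flip

/-- The map `(X, c) ↦ (X, l^*α)`, where `α` is the covector part of `A c`. -/
def pullbackMap (l : W →L[ℝ] V) (A : F →L[ℝ] Big V) : (W × F) →L[ℝ] Big W :=
  (ContinuousLinearMap.fst ℝ W F).prod ((precompMap l).comp
    ((ContinuousLinearMap.snd ℝ V (V →L[ℝ] ℝ)).comp (A.comp (.snd ℝ W F))))

theorem SmoothNear.tangencyMap {l : W → W →L[ℝ] V} {A : W → F →L[ℝ] Big V} {u : W}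
    (hl : SmoothNear l u) (hA : SmoothNear A u) :
    SmoothNear (fun w => tangencyMap (l w) (A w)) u :=
  (hl.clm_comp (.const _)).sub ((SmoothNear.const _).clm_comp (hA.clm_comp (.const _)))

theorem SmoothNear.precompMap {U : Type*} [NormedAddCommGroup U] [NormedSpace ℝ U]
    {l : U → W →L[ℝ] V} {u : U} (hl : SmoothNear l u) :
    SmoothNear (fun w => precompMap (l w)) u := by
  filter_upwards [hl] with w h
  exact (ContinuousLinearMap.contDiff _).contDiffAt.comp w h

theorem SmoothNear.pullbackMap {l : W → W →L[ℝ] V} {A : W → F →L[ℝ] Big V} {u : W}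
    (hl : SmoothNear l u) (hA : SmoothNear A u) :
    SmoothNear (fun w => pullbackMap (l w) (A w)) u := by
  have h2 : SmoothNear (fun w => (ContinuousLinearMap.snd ℝ V (V →L[ℝ] ℝ)).comp
      ((A w).comp (.snd ℝ W F))) u :=
    (SmoothNear.const _).clm_comp (hA.clm_comp (.const _))
  exact SmoothNear.clm_prod (.const _) (hl.precompMap.clm_comp h2)

/-- Presents the pullback as the image of a kernel, so that it is smooth as soon as the kernel and
then the image have constant dimension. -/
theorem map_pullbackMap_ker_tangencyMap (l : W →L[ℝ] V) (A : F →L[ℝ] Big V) :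
    (LinearMap.ker (_root_.tangencyMap l A).toLinearMap).map (_root_.pullbackMap l A).toLinearMap =
      bigPullback l (LinearMap.range A.toLinearMap) := by
  ext x
  constructor
  · rintro ⟨y, hy, rfl⟩
    have hy' : l y.1 - (A y.2).1 = 0 := hy
    rw [sub_eq_zero] at hy'
    exact ⟨(A y.2).2, ⟨y.2, Prod.ext hy'.symm rfl⟩, rfl⟩
  · rintro ⟨α, ⟨c, hc⟩, h⟩
    have hc' : A c = (l x.1, α) := hc
    refine ⟨(x.1, c), ?_, Prod.ext rfl ?_⟩
    · change l x.1 - (A c).1 = 0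
      rw [hc', sub_self]
    · change (A c).2.comp l = x.2
      rw [hc', h]

end

variable {V W F : Type*} [NormedAddCommGroup V] [NormedSpace ℝ V] [FiniteDimensional ℝ V]
  [NormedAddCommGroup W] [NormedSpace ℝ W] [FiniteDimensional ℝ W]
  [NormedAddCommGroup F] [NormedSpace ℝ F] [FiniteDimensional ℝ F]

/-- The pullback of a smooth family of subspaces of constant dimensions has a normalised smooth
frame, the members of which lift smoothly. -/
theorem exists_frame_bigPullback {j : W → V} {ρ : V → W} {u : W} (hj : SmoothNear j u)
    (hρ : SmoothNear ρ (j u)) (hρj : ∀ᶠ w in 𝓝 u, ρ (j w) = w) {A : V → F →L[ℝ] Big V}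
    (hA : SmoothNear A (j u)) (hAinj : ∀ᶠ v in 𝓝 (j u), Function.Injective (A v))
    {E : V → Submodule ℝ (Big V)}
    (hE : ∀ᶠ v in 𝓝 (j u), LinearMap.range (A v).toLinearMap = E v) {d r : ℕ}
    (hd : ∀ᶠ w in 𝓝 u, Module.finrank ℝ (E (j w) ⊓
      (LinearMap.range (fderiv ℝ j w).toLinearMap).prod ⊤ : Submodule ℝ (Big V)) = d)
    (hr : ∀ᶠ w in 𝓝 u, Module.finrank ℝ (bigPullback (fderiv ℝ j w) (E (j w))) = r) :
    ∃ (B : Big W →L[ℝ] (Fin r → ℝ)) (C : W → (Fin r → ℝ) →L[ℝ] Big W)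
      (D : W → (Fin r → ℝ) →L[ℝ] F), SmoothNear C u ∧ SmoothNear D u ∧
      ∀ᶠ w in 𝓝 u, (∀ c, B (C w c) = c) ∧
        LinearMap.range (C w).toLinearMap = bigPullback (fderiv ℝ j w) (E (j w)) ∧
        ∀ c, (A (j w) (D w c)).1 = fderiv ℝ j w (C w c).1 ∧
          (C w c).2 = (A (j w) (D w c)).2.comp (fderiv ℝ j w) := by
  have hinj := eventually_fderiv_leftInverse hj hρ hρj
  have hAj : SmoothNear (fun w => A (j w)) u := hA.comp hj
  set T : W → (W × F) →L[ℝ] V := fun w => tangencyMap (fderiv ℝ j w) (A (j w)) with hTdef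
  have hT : SmoothNear T u := hj.fderiv.tangencyMap hAj
  set R : W → (W × F) →L[ℝ] Big W := fun w => pullbackMap (fderiv ℝ j w) (A (j w)) with hRdef
  have hR : SmoothNear R u := hj.fderiv.pullbackMap hAj
  have hkerT : ∀ᶠ w in 𝓝 u, Module.finrank ℝ (LinearMap.ker (T w).toLinearMap) = d := by
    filter_upwards [hinj, hj.continuousAt.eventually hAinj, hj.continuousAt.eventually hE, hd]
      with w h1 h2 h3 h4
    rw [← h4, ← h3]
    exact finrank_ker_of_range_eq (l := fderiv ℝ j w) (A := (A (j w)).toLinearMap)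
      (Function.LeftInverse.injective h1) h2 fun _ => rfl
  obtain ⟨K, hK, hKT⟩ := exists_smooth_range_eq_ker hT hkerT
  have hrange : ∀ᶠ w in 𝓝 u, LinearMap.range ((R w).comp (K w)).toLinearMap =
      bigPullback (fderiv ℝ j w) (E (j w)) := by
    filter_upwards [hKT, hj.continuousAt.eventually hE] with w h1 h2
    have : LinearMap.range ((R w).comp (K w)).toLinearMap =
        (LinearMap.range (K w).toLinearMap).map (R w).toLinearMap := by
      rw [← LinearMap.range_comp]; rfl
    rw [this, h1, ← h2]
    exact map_pullbackMap_ker_tangencyMap _ _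
  -- `R ∘ K` already spans the pullback, but redundantly. The frame extracted here factors through
  -- `K`, so each of its members comes with coefficients `D` of an element of `E`.
  obtain ⟨B, N, hN, hBN⟩ := exists_smooth_frame_range (hR.clm_comp hK) (r := r) (by
    filter_upwards [hrange, hr] with w h1 h2
    rw [h1, h2])
  refine ⟨B, fun w => ((R w).comp (K w)).comp (N w),
    fun w => (ContinuousLinearMap.snd ℝ W F).comp ((K w).comp (N w)),
    (hR.clm_comp hK).clm_comp hN, (SmoothNear.const _).clm_comp (hK.clm_comp hN), ?_⟩
  filter_upwards [hBN, hrange, hKT] with w h1 h2 h3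
  refine ⟨h1.1, h1.2.trans h2, fun c => ⟨?_, rfl⟩⟩
  have h4 : K w (N w c) ∈ LinearMap.ker (T w).toLinearMap := by
    rw [← h3]; exact ⟨N w c, rfl⟩
  have h5 : fderiv ℝ j w (K w (N w c)).1 - (A (j w) (K w (N w c)).2).1 = 0 := h4
  exact (sub_eq_zero.1 h5).symm

/-- Sections of a pullback lift to related sections. -/
theorem exists_related_lift {j : W → V} {ρ : V → W} {u : W} (hj : SmoothNear j u)
    (hρ : SmoothNear ρ (j u)) (hρj : ∀ᶠ w in 𝓝 u, ρ (j w) = w) {A : V → F →L[ℝ] Big V}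
    (hA : SmoothNear A (j u)) (hAinj : ∀ᶠ v in 𝓝 (j u), Function.Injective (A v))
    {E : V → Submodule ℝ (Big V)}
    (hE : ∀ᶠ v in 𝓝 (j u), LinearMap.range (A v).toLinearMap = E v) {d r : ℕ}
    (hd : ∀ᶠ w in 𝓝 u, Module.finrank ℝ (E (j w) ⊓
      (LinearMap.range (fderiv ℝ j w).toLinearMap).prod ⊤ : Submodule ℝ (Big V)) = d)
    (hr : ∀ᶠ w in 𝓝 u, Module.finrank ℝ (bigPullback (fderiv ℝ j w) (E (j w))) = r)
    {s : W → Big W} (hs : SmoothNear s u)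
    (hsE : ∀ᶠ w in 𝓝 u, s w ∈ bigPullback (fderiv ℝ j w) (E (j w))) :
    ∃ S : V → Big V, SmoothNear S (j u) ∧ (∀ᶠ v in 𝓝 (j u), S v ∈ E v) ∧
      ∀ᶠ w in 𝓝 u, BigRelated j s S w := by
  obtain ⟨B, C, D, hC, hD, h⟩ := exists_frame_bigPullback hj hρ hρj hA hAinj hE hd hr
  have hρu : ρ (j u) = u := hρj.self_of_nhds
  have hs' : SmoothNear s (ρ (j u)) := by rwa [hρu]
  have hD' : SmoothNear D (ρ (j u)) := by rwa [hρu]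
  -- `B` reads off the coefficients of `s` in the frame, and `D` converts them to coefficients for
  -- `A`. Composing with `ρ` extends them off the image of `j`, while `A v` keeps the values in `E
  -- v`.
  refine ⟨fun v => A v (D (ρ v) (B (s (ρ v)))), ?_, ?_, ?_⟩
  · exact hA.clm_apply ((hD'.comp hρ).clm_apply
      ((SmoothNear.clm B).comp (hs'.comp hρ)))
  · filter_upwards [hE] with v hv
    rw [← hv]
    exact ⟨_, rfl⟩
  · filter_upwards [h, hsE, hρj] with w ⟨h1, h2, h3⟩ h4 h5
    rw [← h2] at h4
    obtain ⟨c, hc⟩ := h4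
    have hc' : C w c = s w := hc
    have h6 : C w (B (s w)) = s w := by rw [← hc', h1]
    have h7 := h3 (B (s w))
    rw [h6] at h7
    simp only [BigRelated, h5]
    exact h7

omit [FiniteDimensional ℝ W] in
/-- Smooth sections lift along submersions to related sections. -/
theorem exists_related_lift_of_section {p : W → V} {u : W} (hp : SmoothNear p u)
    {T : V →L[ℝ] W} (hT : ∀ y, fderiv ℝ p u (T y) = y) {S : V → Big V}
    (hS : SmoothNear S (p u)) :
    ∃ s : W → Big W, SmoothNear s u ∧ ∀ᶠ w in 𝓝 u, BigRelated p s S w := by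
  -- `T` is a right inverse of `dp` at `u` only; nearby, `T (D w)⁻¹` is one of `dp` at `w`. Vectors
  -- are lifted by it, covectors pulled back.
  let D : W → V →L[ℝ] V := fun w => (fderiv ℝ p w).comp T
  have hD : SmoothNear D u := hp.fderiv.clm_comp (.const _)
  have hDu : (D u).IsInvertible :=
    ⟨ContinuousLinearEquiv.refl ℝ V, ContinuousLinearMap.ext fun y => (hT y).symm⟩
  refine ⟨fun w => (T ((D w).inverse (S (p w)).1), (S (p w)).2.comp (fderiv ℝ p w)), ?_, ?_⟩
  · exact ((SmoothNear.const T).clm_apply ((hD.inverse hDu).clm_apply (hS.comp hp).fst)).prodMk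
      ((hS.comp hp).snd.clm_comp hp.fderiv)
  · filter_upwards [hD.eventually_isInvertible hDu] with w hw
    exact ⟨(hw.self_apply_inverse _).symm, rfl⟩

end Lift

/-! ### Constancy of integrable families along the fibres of a linear projection. -/

section LocallyConstant

variable {W Z : Type*} [NormedAddCommGroup W] [NormedSpace ℝ W]
  [NormedAddCommGroup Z] [NormedSpace ℝ Z]

/-- A family of isotropic subspaces which is closed under the bracket and contains the kernel of
`q` is locally constant along the fibres of `q`. -/
theorem eventually_eq_of_bracket_closed {q : W →L[ℝ] Z} {L : W → Submodule ℝ (Big W)} {u : W}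
    {r : ℕ} {B : Big W →L[ℝ] (Fin r → ℝ)} {C : W → (Fin r → ℝ) →L[ℝ] Big W}
    (hC : SmoothNear C u)
    (hBC : ∀ᶠ w in 𝓝 u, (∀ c, B (C w c) = c) ∧ LinearMap.range (C w).toLinearMap = L w)
    (hker : ∀ᶠ w in 𝓝 u, ∀ κ, q κ = 0 → ((κ, 0) : Big W) ∈ L w)
    (hiso : ∀ᶠ w in 𝓝 u, L w ≤ (bigMetric W).orthogonal (L w))
    (hbr : ∀ᶠ w in 𝓝 u, ∀ s t : W → Big W, SmoothNear s w → SmoothNear t w →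
      (∀ᶠ x in 𝓝 w, s x ∈ L x) → (∀ᶠ x in 𝓝 w, t x ∈ L x) → flatBracket s t w ∈ L w) :
    ∀ᶠ w in 𝓝 u, q w = q u → L w = L u := by
  -- The bracket of `(κ, 0)` with a frame section is the derivative of that section along `κ`; hence
  -- the derivative lies in `L w`, say equal to `C w c'`. Since `B (C x c) = c` is constant in `x`,
  -- applying `B` gives `c' = 0`.
  have hder : ∀ᶠ w in 𝓝 u, ∀ κ, q κ = 0 → fderiv ℝ C w κ = 0 := by
    filter_upwards [hC.eventually, hBC.eventually_nhds, hker.eventually_nhds,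
      hiso.eventually_nhds, hbr] with w h1 h2 h3 h4 h5 κ hκ
    refine ContinuousLinearMap.ext fun c => ?_
    have ht : SmoothNear (fun x => C x c) w := h1.clm_apply (.const c)
    have htL : ∀ᶠ x in 𝓝 w, C x c ∈ L x := h2.mono fun x hx => by rw [← hx.2]; exact ⟨c, rfl⟩
    have h6 := h5 (fun _ => (κ, 0)) (fun x => C x c) (.const _) ht (h3.mono fun x hx => hx κ hκ)
      htL
    have h7 : ∀ᶠ x in 𝓝 w, (C x c).2 κ = 0 := by
      filter_upwards [h3, h4, htL] with x hx1 hx2 hx3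
      have := hx2 hx3 _ (hx1 κ hκ)
      simpa [bigMetric] using this
    rw [flatBracket_const ht.differentiableAt h7] at h6
    have h8 : HasFDerivAt (fun x => B (C x c)) (B.comp (fderiv ℝ (fun x => C x c) w)) w :=
      B.hasFDerivAt.comp w ht.differentiableAt.hasFDerivAt
    have h9 := h8.unique ((hasFDerivAt_const c w).congr_of_eventuallyEq
      (h2.mono fun x hx => hx.1 c))
    have h10 : fderiv ℝ (fun x => C x c) w κ = fderiv ℝ C w κ c := by
      rw [(h1.differentiableAt.hasFDerivAt.clm_apply (hasFDerivAt_const c w)).fderiv]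
      simp
    rw [← h2.self_of_nhds.2] at h6
    obtain ⟨c', hc'⟩ := h6
    have hc'' : C w c' = fderiv ℝ (fun x => C x c) w κ := hc'
    have h11 : B (fderiv ℝ (fun x => C x c) w κ) = 0 := DFunLike.congr_fun h9 κ
    rw [← hc'', h2.self_of_nhds.1] at h11
    rw [← h10, ← hc'', h11, map_zero]; rfl
  -- A ball is convex, so it contains the segment from `u` to any of its points `w`. If `q w = q u`,
  -- this segment runs in a direction of `ker q`, and `C` is constant on it.
  obtain ⟨ε, hε, hball⟩ := Metric.eventually_nhds_iff_ball.1 (hder.and (hC.and hBC))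
  filter_upwards [Metric.ball_mem_nhds u hε] with w hw hq
  have hseg : ∀ t ∈ Set.Icc (0 : ℝ) 1, u + t • (w - u) ∈ Metric.ball u ε := by
    intro t ht
    rw [mem_ball_iff_norm] at hw ⊢
    rw [add_sub_cancel_left, norm_smul, Real.norm_of_nonneg ht.1]
    nlinarith [ht.2, norm_nonneg (w - u)]
  have hκ : q (w - u) = 0 := by rw [map_sub, hq, sub_self]
  have hd : ∀ t ∈ Set.Icc (0 : ℝ) 1, HasDerivAt (fun t : ℝ => C (u + t • (w - u))) 0 t := by
    intro t ht
    obtain ⟨h1, h2, -⟩ := hball _ (hseg t ht)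
    have h3 : HasDerivAt (fun t : ℝ => u + t • (w - u)) (w - u) t := by
      simpa using ((hasDerivAt_id t).smul_const (w - u)).const_add u
    have := (h2.differentiableAt (by simp)).hasFDerivAt.comp_hasDerivAt t h3
    rwa [h1 _ hκ] at this
  have hconst := constant_of_has_deriv_right_zero (a := (0 : ℝ)) (b := 1)
    (f := fun t : ℝ => C (u + t • (w - u)))
    (fun t ht => (hd t ht).continuousAt.continuousWithinAt)
    (fun t ht => (hd t ⟨ht.1, ht.2.le⟩).hasDerivWithinAt) 1 (by simp)
  simp only [one_smul, add_sub_cancel, zero_smul, add_zero] at hconst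
  rw [← (hball w hw).2.2.2, ← (hball u (Metric.mem_ball_self hε)).2.2.2, hconst]

end LocallyConstant

/-! ### Sections, subbundles and the Courant bracket in the preferred charts. -/

section ChartCoordinates

variable {V : Type*} [NormedAddCommGroup V] [NormedSpace ℝ V]
  {M : Type*} [TopologicalSpace M] [ChartedSpace V M]

instance {x : M} : T2Space (TangentSpace 𝓘(ℝ, V) x) := inferInstanceAs (T2Space V)

instance [FiniteDimensional ℝ V] {x : M} : FiniteDimensional ℝ (TangentSpace 𝓘(ℝ, V) x) :=
  inferInstanceAs (FiniteDimensional ℝ V)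

variable (V) in
/-- The inverse of the preferred chart at `y`. -/
abbrev chartInv (y : M) : V → M := (extChartAt 𝓘(ℝ, V) y).symm

/-- The coordinates with respect to the preferred chart at `y` of the value of `σ` at `x`. -/
def chartCoord (y : M) (σ : ∀ x : M, BigTangent V x) (x : M) : Big V :=
  (mfderiv 𝓘(ℝ, V) 𝓘(ℝ, V) (extChartAt 𝓘(ℝ, V) y) x (σ x).1,
    (σ x).2.comp (mfderiv 𝓘(ℝ, V) 𝓘(ℝ, V) (extChartAt 𝓘(ℝ, V) y) x).inverse)

/-- The linear map underlying `chartCoord`. -/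
def fiberCoord (y x : M) : BigTangent V x →ₗ[ℝ] Big V where
  toFun w := (mfderiv 𝓘(ℝ, V) 𝓘(ℝ, V) (extChartAt 𝓘(ℝ, V) y) x w.1,
    w.2.comp (mfderiv 𝓘(ℝ, V) 𝓘(ℝ, V) (extChartAt 𝓘(ℝ, V) y) x).inverse)
  map_add' _ _ := Prod.ext (map_add _ _ _) rfl
  map_smul' _ _ := Prod.ext (map_smul _ _ _) rfl

theorem chartCoord_eq_fiberCoord (y : M) (σ : ∀ x : M, BigTangent V x) (x : M) :
    chartCoord y σ x = fiberCoord y x (σ x) := rfl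

/-- The coordinate expression of a section of the big tangent bundle. -/
def chartSection (y : M) (σ : ∀ x : M, BigTangent V x) (v : V) : Big V :=
  (chartVectorField y (fun x => (σ x).1) v, chartOneForm y (fun x => (σ x).2) v)

/-- The section of the big tangent bundle with a given coordinate expression. -/
def sectionOfChart (y : M) (s : V → Big V) (x : M) : BigTangent V x :=
  ((mfderiv 𝓘(ℝ, V) 𝓘(ℝ, V) (extChartAt 𝓘(ℝ, V) y) x).inverse (s (extChartAt 𝓘(ℝ, V) y x)).1,
    (s (extChartAt 𝓘(ℝ, V) y x)).2.comp (mfderiv 𝓘(ℝ, V) 𝓘(ℝ, V) (extChartAt 𝓘(ℝ, V) y) x))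

theorem chartInv_extChartAt (y : M) : chartInv V y (extChartAt 𝓘(ℝ, V) y y) = y :=
  extChartAt_to_inv y

theorem extChartAt_target_mem_nhds_self (y : M) :
    (extChartAt 𝓘(ℝ, V) y).target ∈ 𝓝 (extChartAt 𝓘(ℝ, V) y y) :=
  extChartAt_target_mem_nhds y

theorem eventually_chartInv {y : M} {U : Set M} (hU : U ∈ 𝓝 y) :
    ∀ᶠ v in 𝓝 (extChartAt 𝓘(ℝ, V) y y), chartInv V y v ∈ U :=
  (continuousAt_extChartAt_symm y).eventually (by rw [extChartAt_to_inv]; exact hU)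

variable [IsManifold 𝓘(ℝ, V) ∞ M]

theorem mdifferentiableAt_chartInv {y : M} {v : V} (hv : v ∈ (extChartAt 𝓘(ℝ, V) y).target) :
    MDifferentiableAt 𝓘(ℝ, V) 𝓘(ℝ, V) (chartInv V y) v := by
  have := mdifferentiableWithinAt_extChartAt_symm (I := 𝓘(ℝ, V)) hv
  rwa [ModelWithCorners.range_eq_univ, mdifferentiableWithinAt_univ] at this

theorem contMDiffAt_chartInv {y : M} {v : V} (hv : v ∈ (extChartAt 𝓘(ℝ, V) y).target) :
    ContMDiffAt 𝓘(ℝ, V) 𝓘(ℝ, V) ∞ (chartInv V y) v :=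
  (contMDiffOn_extChartAt_symm y).contMDiffAt ((isOpen_extChartAt_target y).mem_nhds hv)

theorem mfderiv_extChartAt_comp_chartInv {y : M} {v : V}
    (hv : v ∈ (extChartAt 𝓘(ℝ, V) y).target) :
    (mfderiv 𝓘(ℝ, V) 𝓘(ℝ, V) (extChartAt 𝓘(ℝ, V) y) (chartInv V y v)).comp
      (mfderiv 𝓘(ℝ, V) 𝓘(ℝ, V) (chartInv V y) v) = ContinuousLinearMap.id _ _ := by
  have := mfderiv_extChartAt_comp_mfderivWithin_extChartAt_symm (I := 𝓘(ℝ, V)) hv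
  rwa [ModelWithCorners.range_eq_univ, mfderivWithin_univ] at this

theorem mfderiv_chartInv_comp_extChartAt {y : M} {v : V}
    (hv : v ∈ (extChartAt 𝓘(ℝ, V) y).target) :
    (mfderiv 𝓘(ℝ, V) 𝓘(ℝ, V) (chartInv V y) v).comp
      (mfderiv 𝓘(ℝ, V) 𝓘(ℝ, V) (extChartAt 𝓘(ℝ, V) y) (chartInv V y v)) =
      ContinuousLinearMap.id _ _ := by
  have := mfderivWithin_extChartAt_symm_comp_mfderiv_extChartAt (I := 𝓘(ℝ, V)) hv
  rwa [ModelWithCorners.range_eq_univ, mfderivWithin_univ] at this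

theorem inverse_mfderiv_chartInv {y : M} {v : V} (hv : v ∈ (extChartAt 𝓘(ℝ, V) y).target) :
    (mfderiv 𝓘(ℝ, V) 𝓘(ℝ, V) (chartInv V y) v).inverse =
      mfderiv 𝓘(ℝ, V) 𝓘(ℝ, V) (extChartAt 𝓘(ℝ, V) y) (chartInv V y v) :=
  ContinuousLinearMap.inverse_eq (mfderiv_chartInv_comp_extChartAt hv)
    (mfderiv_extChartAt_comp_chartInv hv)

theorem inverse_mfderiv_extChartAt {y : M} {v : V} (hv : v ∈ (extChartAt 𝓘(ℝ, V) y).target) :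
    (mfderiv 𝓘(ℝ, V) 𝓘(ℝ, V) (extChartAt 𝓘(ℝ, V) y) (chartInv V y v)).inverse =
      mfderiv 𝓘(ℝ, V) 𝓘(ℝ, V) (chartInv V y) v :=
  ContinuousLinearMap.inverse_eq (mfderiv_extChartAt_comp_chartInv hv)
    (mfderiv_chartInv_comp_extChartAt hv)

theorem chartSection_eq {y : M} {v : V} (hv : v ∈ (extChartAt 𝓘(ℝ, V) y).target)
    (σ : ∀ x : M, BigTangent V x) : chartSection y σ v = chartCoord y σ (chartInv V y v) := by
  refine Prod.ext ?_ ?_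
  · change (mfderiv 𝓘(ℝ, V) 𝓘(ℝ, V) (chartInv V y) v).inverse _ = _
    rw [inverse_mfderiv_chartInv hv]; rfl
  · change _ = (σ (chartInv V y v)).2.comp
      (mfderiv 𝓘(ℝ, V) 𝓘(ℝ, V) (extChartAt 𝓘(ℝ, V) y) (chartInv V y v)).inverse
    rw [inverse_mfderiv_extChartAt hv]; rfl

theorem chartCoord_sectionOfChart {y x : M} (hx : x ∈ (chartAt V y).source) (s : V → Big V) :
    chartCoord y (sectionOfChart y s) x = s (extChartAt 𝓘(ℝ, V) y x) := by
  have hx' : x ∈ (extChartAt 𝓘(ℝ, V) y).source := by rwa [extChartAt_source]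
  have h := isInvertible_mfderiv_extChartAt (I := 𝓘(ℝ, V)) hx'
  refine Prod.ext (h.self_apply_inverse _) ?_
  refine ContinuousLinearMap.ext fun X => ?_
  exact congrArg (s (extChartAt 𝓘(ℝ, V) y x)).2 (h.self_apply_inverse X)

theorem chartSection_sectionOfChart {y : M} {v : V}
    (hv : v ∈ (extChartAt 𝓘(ℝ, V) y).target) (s : V → Big V) :
    chartSection y (sectionOfChart y s) v = s v := by
  have h : chartInv V y v ∈ (chartAt V y).source := by
    rw [← extChartAt_source 𝓘(ℝ, V)]; exact (extChartAt 𝓘(ℝ, V) y).map_target hv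
  rw [chartSection_eq hv, chartCoord_sectionOfChart h, (extChartAt 𝓘(ℝ, V) y).right_inv hv]

/-- Over the chart domain at `y`, the trivialisations of `TM` and `T^*M` are given by the derivative
of the chart and by precomposition with its inverse. -/
theorem isSmoothBigSectionOn_iff_chartCoord {y : M} {σ : ∀ x : M, BigTangent V x} {U : Set M}
    (hU : IsOpen U) (hUy : U ⊆ (chartAt V y).source) :
    IsSmoothBigSectionOn σ U ↔ ContMDiffOn 𝓘(ℝ, V) 𝓘(ℝ, Big V) ∞ (chartCoord y σ) U := by
  have h1 := (trivializationAt V (TangentSpace 𝓘(ℝ, V)) y).contMDiffOn_section_iff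
    (IB := 𝓘(ℝ, V)) (n := ∞) (s := fun x => (σ x).1) hU hUy
  have h2 := (trivializationAt (V →L[ℝ] ℝ)
    (fun x : M => TangentSpace 𝓘(ℝ, V) x →L[ℝ] ℝ) y).contMDiffOn_section_iff
    (IB := 𝓘(ℝ, V)) (n := ∞) (s := fun x => (σ x).2) hU
    (by
      rw [hom_trivializationAt_baseSet]
      exact fun x hx => ⟨hUy hx, trivial⟩)
  have e1 : ∀ x ∈ U, (trivializationAt V (TangentSpace 𝓘(ℝ, V)) y ⟨x, (σ x).1⟩).2 =
      (chartCoord y σ x).1 := by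
    intro x hx
    have := TangentBundle.continuousLinearMapAt_trivializationAt (I := 𝓘(ℝ, V)) (hUy hx)
    have h3 := DFunLike.congr_fun this (σ x).1
    rw [Bundle.Trivialization.continuousLinearMapAt_apply,
      Bundle.Trivialization.linearMapAt_apply, if_pos (by exact hUy hx)] at h3
    exact h3
  have e2 : ∀ x ∈ U, (trivializationAt (V →L[ℝ] ℝ)
      (fun x : M => TangentSpace 𝓘(ℝ, V) x →L[ℝ] ℝ) y ⟨x, (σ x).2⟩).2 =
      (chartCoord y σ x).2 := by
    intro x hx
    set e := trivializationAt V (TangentSpace 𝓘(ℝ, V) : M → Type _) y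
    have hb : x ∈ e.baseSet := hUy hx
    have h3 : e.continuousLinearMapAt ℝ x =
        mfderiv 𝓘(ℝ, V) 𝓘(ℝ, V) (extChartAt 𝓘(ℝ, V) y) x :=
      TangentBundle.continuousLinearMapAt_trivializationAt (I := 𝓘(ℝ, V)) (hUy hx)
    have h4 : (e.continuousLinearMapAt ℝ x).inverse = e.symmL ℝ x :=
      ContinuousLinearMap.inverse_eq
        (ContinuousLinearMap.ext fun X => e.continuousLinearMapAt_symmL hb X)
        (ContinuousLinearMap.ext fun X => e.symmL_continuousLinearMapAt hb X)
    have h5 : (chartCoord y σ x).2 = (σ x).2.comp (e.symmL ℝ x) := by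
      rw [← h4]
      exact congrArg (fun l => (σ x).2.comp (ContinuousLinearMap.inverse l)) h3.symm
    rw [h5, hom_trivializationAt_apply]
    refine ContinuousLinearMap.ext fun X => ?_
    simp only [ContinuousLinearMap.inCoordinates, ContinuousLinearMap.comp_apply]
    exact DFunLike.congr_fun (Bundle.Trivial.continuousLinearMapAt_trivialization (𝕜 := ℝ) (B := M)
      (F := ℝ) x) _
  rw [contMDiffOn_prod_module_iff]
  constructor
  · intro h
    exact ⟨(h1.1 h.vectorField).congr fun x hx => (e1 x hx).symm,
      (h2.1 h.oneForm).congr fun x hx => (e2 x hx).symm⟩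
  · intro h
    exact ⟨h1.2 (h.1.congr e1), h2.2 (h.2.congr e2)⟩

theorem smoothNear_chartSection {y : M} {σ : ∀ x : M, BigTangent V x} {U : Set M}
    (hU : U ∈ 𝓝 y) (hσ : IsSmoothBigSectionOn σ U) :
    SmoothNear (chartSection y σ) (extChartAt 𝓘(ℝ, V) y y) := by
  obtain ⟨O, hOU, hO, hyO⟩ := mem_nhds_iff.1
    (inter_mem hU ((chartAt V y).open_source.mem_nhds (mem_chart_source V y)))
  have h1 : IsSmoothBigSectionOn σ O :=
    ⟨hσ.1.mono fun x hx => (hOU hx).1, hσ.2.mono fun x hx => (hOU hx).1⟩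
  have h2 := (isSmoothBigSectionOn_iff_chartCoord hO fun x hx => (hOU hx).2).1 h1
  have h3 : ContinuousAt (chartInv V y) (extChartAt 𝓘(ℝ, V) y y) := continuousAt_extChartAt_symm y
  have h4 : ∀ᶠ v in 𝓝 (extChartAt 𝓘(ℝ, V) y y), chartInv V y v ∈ O :=
    h3.eventually (hO.mem_nhds (by rwa [chartInv_extChartAt]))
  have h5 : ∀ᶠ v in 𝓝 (extChartAt 𝓘(ℝ, V) y y), v ∈ (extChartAt 𝓘(ℝ, V) y).target :=
    extChartAt_target_mem_nhds_self y
  filter_upwards [h4.eventually_nhds, h5.eventually_nhds] with v h6 h7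
  rw [← contMDiffAt_iff_contDiffAt]
  have h8 := (h2.contMDiffAt (hO.mem_nhds h6.self_of_nhds)).comp v
    (contMDiffAt_chartInv h7.self_of_nhds)
  exact h8.congr_of_eventuallyEq (h7.mono fun w hw => chartSection_eq hw σ)

theorem exists_isSmoothBigSectionOn_sectionOfChart {y : M} {s : V → Big V}
    (hs : SmoothNear s (extChartAt 𝓘(ℝ, V) y y)) :
    ∃ U : Set M, IsOpen U ∧ y ∈ U ∧ IsSmoothBigSectionOn (sectionOfChart y s) U := by
  obtain ⟨O, hOs, hO, hyO⟩ := mem_nhds_iff.1 hs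
  refine ⟨(chartAt V y).source ∩ extChartAt 𝓘(ℝ, V) y ⁻¹' O, ?_, ⟨mem_chart_source V y, hyO⟩, ?_⟩
  · rw [← extChartAt_source 𝓘(ℝ, V)]
    exact isOpen_extChartAt_preimage' y hO
  · have hopen : IsOpen ((chartAt V y).source ∩ extChartAt 𝓘(ℝ, V) y ⁻¹' O) := by
      rw [← extChartAt_source 𝓘(ℝ, V)]
      exact isOpen_extChartAt_preimage' y hO
    rw [isSmoothBigSectionOn_iff_chartCoord hopen fun x hx => hx.1]
    have h1 : ContMDiffOn 𝓘(ℝ, V) 𝓘(ℝ, Big V) ∞ (fun x => s (extChartAt 𝓘(ℝ, V) y x))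
        ((chartAt V y).source ∩ extChartAt 𝓘(ℝ, V) y ⁻¹' O) := by
      rintro x ⟨hx1, hx2⟩
      have h2 : ContMDiffAt 𝓘(ℝ, V) 𝓘(ℝ, Big V) ∞ s (extChartAt 𝓘(ℝ, V) y x) :=
        contMDiffAt_iff_contDiffAt.2 (hOs hx2)
      exact (h2.comp x (contMDiffAt_extChartAt' hx1)).contMDiffWithinAt
    exact h1.congr fun x hx => chartCoord_sectionOfChart hx.1 s

/-- The Courant bracket in coordinates. -/
theorem courantBracket_eq_flatBracket {y : M} {σ τ : ∀ x : M, BigTangent V x} {U : Set M}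
    (hU : U ∈ 𝓝 y) (hσ : IsSmoothBigSectionOn σ U) (hτ : IsSmoothBigSectionOn τ U) :
    (courantBracket σ τ y : Big V) =
      flatBracket (chartSection y σ) (chartSection y τ) (extChartAt 𝓘(ℝ, V) y y) := by
  have hs := (smoothNear_chartSection hU hσ).differentiableAt
  have ht := (smoothNear_chartSection hU hτ).differentiableAt
  -- The tangent space at `y` is identified with `V` through this very chart, so at `y` itself
  -- coordinates change nothing.
  have hid : mfderiv 𝓘(ℝ, V) 𝓘(ℝ, V) (extChartAt 𝓘(ℝ, V) y) y = ContinuousLinearMap.id ℝ V :=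
    mfderiv_extChartAt_self
  have hidX : ∀ X : TangentSpace 𝓘(ℝ, V) y,
      mfderiv 𝓘(ℝ, V) 𝓘(ℝ, V) (extChartAt 𝓘(ℝ, V) y) y X = X := fun X => DFunLike.congr_fun hid X
  have hinvX : ∀ X : V,
      (mfderiv 𝓘(ℝ, V) 𝓘(ℝ, V) (extChartAt 𝓘(ℝ, V) y) y).inverse X = X := by
    intro X
    have h := isInvertible_mfderiv_extChartAt (I := 𝓘(ℝ, V)) (mem_extChartAt_source (I := 𝓘(ℝ, V)) y)
    exact (hidX _).symm.trans (h.self_apply_inverse X)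
  refine Prod.ext ?_ ?_
  · change mlieBracket 𝓘(ℝ, V) (fun y => (σ y).1) (fun y => (τ y).1) y = _
    rw [← mlieBracketWithin_univ, mlieBracketWithin_apply]
    refine (hinvX _).trans ?_
    simp only [Set.preimage_univ, Set.univ_inter, ModelWithCorners.range_eq_univ,
      mpullbackWithin_univ]
    exact congrFun (lieBracketWithin_univ (𝕜 := ℝ) (V := chartVectorField y fun y => (σ y).1)
      (W := chartVectorField y fun y => (τ y).1)) _
  · set F : V → ℝ := fun v => (chartSection y σ v).2 (chartSection y τ v).1 -
      (chartSection y τ v).2 (chartSection y σ v).1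
    have hF : DifferentiableAt ℝ F (extChartAt 𝓘(ℝ, V) y y) :=
      (hs.snd.clm_apply ht.fst).sub (ht.snd.clm_apply hs.fst)
    have hFe : (fun x => (σ x).2 (τ x).1 - (τ x).2 (σ x).1) =ᶠ[𝓝 y]
        F ∘ extChartAt 𝓘(ℝ, V) y := by
      filter_upwards [extChartAt_source_mem_nhds (I := 𝓘(ℝ, V)) y] with x hx
      have hx' : chartInv V y (extChartAt 𝓘(ℝ, V) y x) = x := (extChartAt 𝓘(ℝ, V) y).left_inv hx
      have h := isInvertible_mfderiv_extChartAt (I := 𝓘(ℝ, V)) hx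
      have hc : ∀ σ : ∀ x : M, BigTangent V x,
          chartSection y σ (extChartAt 𝓘(ℝ, V) y x) = chartCoord y σ x := by
        intro σ
        rw [chartSection_eq ((extChartAt 𝓘(ℝ, V) y).map_source hx), hx']
      simp only [Function.comp_apply, F, hc]
      exact congrArg₂ (· - ·) (congrArg (σ x).2 (h.inverse_apply_self (τ x).1).symm)
        (congrArg (τ x).2 (h.inverse_apply_self (σ x).1).symm)
    have hd : ∀ Y : TangentSpace 𝓘(ℝ, V) y,
        dFun (V := V) (fun x => (σ x).2 (τ x).1 - (τ x).2 (σ x).1) y Y =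
          fderiv ℝ F (extChartAt 𝓘(ℝ, V) y y) Y := by
      intro Y
      unfold dFun
      have h1 : mfderiv 𝓘(ℝ, V) 𝓘(ℝ, ℝ) (fun x => (σ x).2 (τ x).1 - (τ x).2 (σ x).1) y =
          mfderiv 𝓘(ℝ, V) 𝓘(ℝ, ℝ) (F ∘ extChartAt 𝓘(ℝ, V) y) y := hFe.mfderiv_eq
      have h2 : mfderiv 𝓘(ℝ, V) 𝓘(ℝ, ℝ) (F ∘ extChartAt 𝓘(ℝ, V) y) y =
          (mfderiv 𝓘(ℝ, V) 𝓘(ℝ, ℝ) F (extChartAt 𝓘(ℝ, V) y y)).comp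
            (mfderiv 𝓘(ℝ, V) 𝓘(ℝ, V) (extChartAt 𝓘(ℝ, V) y) y) :=
        mfderiv_comp y hF.mdifferentiableAt (mdifferentiableAt_extChartAt (mem_chart_source V y))
      have h3 : mfderiv 𝓘(ℝ, V) 𝓘(ℝ, ℝ) F (extChartAt 𝓘(ℝ, V) y y) =
          fderiv ℝ F (extChartAt 𝓘(ℝ, V) y y) := mfderiv_eq_fderiv
      refine (DFunLike.congr_fun (h1.trans h2) Y).trans ?_
      rw [h3]
      exact congrArg (fderiv ℝ F (extChartAt 𝓘(ℝ, V) y y)) (hidX Y)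
    refine ContinuousLinearMap.ext fun Y => ?_
    have hl : ∀ (X : ∀ y : M, TangentSpace 𝓘(ℝ, V) y)
        (β : ∀ y : M, TangentSpace 𝓘(ℝ, V) y →L[ℝ] ℝ),
        lieDerivOneForm X β y Y = (fderiv ℝ (chartOneForm y β) (extChartAt 𝓘(ℝ, V) y y)
          (chartVectorField y X (extChartAt 𝓘(ℝ, V) y y)) +
          (chartOneForm y β (extChartAt 𝓘(ℝ, V) y y)).comp
            (fderiv ℝ (chartVectorField y X) (extChartAt 𝓘(ℝ, V) y y))) Y := fun X β =>
      congrArg (fun Z : V => (fderiv ℝ (chartOneForm y β) (extChartAt 𝓘(ℝ, V) y y)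
          (chartVectorField y X (extChartAt 𝓘(ℝ, V) y y)) +
          (chartOneForm y β (extChartAt 𝓘(ℝ, V) y y)).comp
            (fderiv ℝ (chartVectorField y X) (extChartAt 𝓘(ℝ, V) y y))) Z) (hidX Y)
    change lieDerivOneForm (fun y => (σ y).1) (fun y => (τ y).2) y Y
      - lieDerivOneForm (fun y => (τ y).1) (fun y => (σ y).2) y Y
      + (1 / 2 : ℝ) • dFun (V := V) (fun x => (σ x).2 (τ x).1 - (τ x).2 (σ x).1) y Y = _
    rw [hl, hl, hd]
    rfl

theorem fiberCoord_injective {y x : M} (hx : x ∈ (extChartAt 𝓘(ℝ, V) y).source) :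
    Function.Injective (fiberCoord (V := V) y x) := by
  have h := isInvertible_mfderiv_extChartAt (I := 𝓘(ℝ, V)) hx
  intro w w' hw
  refine Prod.ext ?_ ?_
  · have h1 := congrArg Prod.fst hw
    exact (h.inverse_apply_self w.1).symm.trans ((congrArg _ h1).trans (h.inverse_apply_self w'.1))
  · refine ContinuousLinearMap.ext fun X => ?_
    have h1 := DFunLike.congr_fun (congrArg Prod.snd hw)
      (mfderiv 𝓘(ℝ, V) 𝓘(ℝ, V) (extChartAt 𝓘(ℝ, V) y) x X)
    exact (congrArg w.2 (h.inverse_apply_self X).symm).trans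
      (h1.trans (congrArg w'.2 (h.inverse_apply_self X)))

/-- Taking coordinates of `E` is thereby a special case of pulling back along a map, so one calculus
of pullbacks covers charts as well as `ι` and `π`. -/
theorem map_fiberCoord {y : M} {v : V} (hv : v ∈ (extChartAt 𝓘(ℝ, V) y).target)
    (E : ∀ x : M, Submodule ℝ (BigTangent V x)) :
    (E (chartInv V y v)).map (fiberCoord y (chartInv V y v)) =
      pullbackField (W := V) (chartInv V y) E v := by
  have h1 := fun X => DFunLike.congr_fun (mfderiv_chartInv_comp_extChartAt hv) X
  have h2 := fun X => DFunLike.congr_fun (mfderiv_extChartAt_comp_chartInv hv) X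
  have h3 := inverse_mfderiv_extChartAt hv
  ext u
  constructor
  · rintro ⟨w, hw, rfl⟩
    refine ⟨w.2, ?_, congrArg w.2.comp h3⟩
    have : (mfderiv 𝓘(ℝ, V) 𝓘(ℝ, V) (chartInv V y) v (fiberCoord y (chartInv V y v) w).1, w.2) =
        w := Prod.ext (h1 w.1) rfl
    rw [this]; exact hw
  · rintro ⟨α, hα, hu⟩
    refine ⟨_, hα, Prod.ext (h2 u.1) ?_⟩
    exact (congrArg α.comp h3).trans hu.symm

theorem chartSection_mem_iff {y : M} {v : V} (hv : v ∈ (extChartAt 𝓘(ℝ, V) y).target)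
    (E : ∀ x : M, Submodule ℝ (BigTangent V x)) (σ : ∀ x : M, BigTangent V x) :
    chartSection y σ v ∈ pullbackField (W := V) (chartInv V y) E v ↔
      σ (chartInv V y v) ∈ E (chartInv V y v) := by
  rw [← map_fiberCoord hv, chartSection_eq hv, chartCoord_eq_fiberCoord]
  exact (fiberCoord_injective ((extChartAt 𝓘(ℝ, V) y).map_target hv)).mem_set_image

theorem pullbackField_chartInv_self (E : ∀ x : M, Submodule ℝ (BigTangent V x)) (y : M) :
    (pullbackField (W := V) (chartInv V y) E (extChartAt 𝓘(ℝ, V) y y) : Submodule ℝ (Big V)) =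
      E y := by
  have h1 : mfderiv 𝓘(ℝ, V) 𝓘(ℝ, V) (chartInv V y) (extChartAt 𝓘(ℝ, V) y y) =
      ContinuousLinearMap.id ℝ V := by
    have := mfderivWithin_range_extChartAt_symm (I := 𝓘(ℝ, V)) (x := y)
    rwa [ModelWithCorners.range_eq_univ, mfderivWithin_univ] at this
  -- All tangent spaces unfold to `V`; as a family in one fixed type, `E` can be rewritten along an
  -- equality of base points.
  let E' : M → Submodule ℝ (Big V) := fun x => E x
  have h2 : (E (chartInv V y (extChartAt 𝓘(ℝ, V) y y)) : Submodule ℝ (Big V)) = E y :=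
    congrArg E' (chartInv_extChartAt y)
  have h3 : (pullbackField (W := V) (chartInv V y) E (extChartAt 𝓘(ℝ, V) y y) :
      Submodule ℝ (Big V)) = bigPullback (ContinuousLinearMap.id ℝ V)
        (E (chartInv V y (extChartAt 𝓘(ℝ, V) y y)) : Submodule ℝ (Big V)) :=
    congrArg (fun l : V →L[ℝ] V => bigPullback l
      (E (chartInv V y (extChartAt 𝓘(ℝ, V) y y)) : Submodule ℝ (Big V))) h1
  exact h3.trans ((bigPullback_id _).trans h2)

/-- Integrability is local: the bracket of local sections takes values in the structure. -/
theorem IsCourantClosed.flatBracket_mem [FiniteDimensional ℝ V] [T2Space M]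
    {E : ∀ x : M, Submodule ℝ (BigTangent V x)} (hE : IsCourantClosed E) {y : M}
    {s t : V → Big V} (hs : SmoothNear s (extChartAt 𝓘(ℝ, V) y y))
    (ht : SmoothNear t (extChartAt 𝓘(ℝ, V) y y))
    (hsE : ∀ᶠ v in 𝓝 (extChartAt 𝓘(ℝ, V) y y),
      s v ∈ pullbackField (W := V) (chartInv V y) E v)
    (htE : ∀ᶠ v in 𝓝 (extChartAt 𝓘(ℝ, V) y y),
      t v ∈ pullbackField (W := V) (chartInv V y) E v) :
    flatBracket s t (extChartAt 𝓘(ℝ, V) y y) ∈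
      (pullbackField (W := V) (chartInv V y) E (extChartAt 𝓘(ℝ, V) y y) :
        Submodule ℝ (Big V)) := by
  have key : ∀ s : V → Big V, SmoothNear s (extChartAt 𝓘(ℝ, V) y y) →
      (∀ᶠ v in 𝓝 (extChartAt 𝓘(ℝ, V) y y), s v ∈ pullbackField (W := V) (chartInv V y) E v) →
      ∃ σ : ∀ x : M, BigTangent V x, IsSmoothBigSectionOn σ Set.univ ∧ (∀ x, σ x ∈ E x) ∧
        chartSection y σ =ᶠ[𝓝 (extChartAt 𝓘(ℝ, V) y y)] s := by
    intro s hs hsE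
    obtain ⟨U, hU, hyU, hσ⟩ := exists_isSmoothBigSectionOn_sectionOfChart hs
    have htarget : ∀ᶠ v in 𝓝 (extChartAt 𝓘(ℝ, V) y y), v ∈ (extChartAt 𝓘(ℝ, V) y).target :=
      extChartAt_target_mem_nhds_self y
    have hmem : ∀ᶠ x in 𝓝 y, sectionOfChart y s x ∈ E x := by
      have h1 := (continuousAt_extChartAt (I := 𝓘(ℝ, V)) y).eventually (hsE.and htarget)
      filter_upwards [h1, extChartAt_source_mem_nhds (I := 𝓘(ℝ, V)) y] with x hx hx'
      rw [← chartSection_sectionOfChart hx.2 s, chartSection_mem_iff hx.2] at hx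
      have h2 : chartInv V y (extChartAt 𝓘(ℝ, V) y x) = x := (extChartAt 𝓘(ℝ, V) y).left_inv hx'
      have h3 := hx.1
      rwa [h2] at h3
    obtain ⟨O, hOU, hO, hyO⟩ := mem_nhds_iff.1 (inter_mem (hU.mem_nhds hyU) hmem)
    -- Integrability speaks of global sections only. Multiplying by a bump function keeps the values
    -- in `E` and does not change the section near `y`, hence not the bracket at `y`.
    obtain ⟨ψ, -, hψ⟩ := (SmoothBumpFunction.nhds_basis_tsupport (I := 𝓘(ℝ, V)) y).mem_iff.1
      (hO.mem_nhds hyO)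
    refine ⟨fun x => ψ x • sectionOfChart y s x, ⟨?_, ?_⟩, fun x => ?_, ?_⟩
    · exact (ContMDiffOn.smul_section_of_tsupport (s := fun x => (sectionOfChart y s x).1)
        ψ.contMDiff.contMDiffOn hO hψ (hσ.1.mono fun x hx => (hOU hx).1)).contMDiffOn
    · exact (ContMDiffOn.smul_section_of_tsupport (F := V →L[ℝ] ℝ)
        (V := fun x : M => TangentSpace 𝓘(ℝ, V) x →L[ℝ] ℝ)
        (s := fun x => (sectionOfChart y s x).2)
        ψ.contMDiff.contMDiffOn hO hψ (hσ.2.mono fun x hx => (hOU hx).1)).contMDiffOn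
    · by_cases hx : x ∈ tsupport ψ
      · exact (E x).smul_mem _ (hOU (hψ hx)).2
      · have : ψ x = 0 := image_eq_zero_of_notMem_tsupport hx
        simp [this]
    · filter_upwards [htarget, eventually_chartInv (V := V) ψ.eventuallyEq_one] with v hv h1
      have h2 : ψ (chartInv V y v) = 1 := h1
      rw [chartSection_eq hv, ← chartSection_sectionOfChart hv s, chartSection_eq hv]
      simp only [chartCoord_eq_fiberCoord, h2, one_smul]
  obtain ⟨σ, hσ, hσE, hσs⟩ := key s hs hsE
  obtain ⟨τ, hτ, hτE, hτt⟩ := key t ht htE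
  have h1 := hE σ τ hσ hτ hσE hτE y
  rw [pullbackField_chartInv_self, ← flatBracket_congr hσs hτt,
    ← courantBracket_eq_flatBracket univ_mem hσ hτ]
  exact h1

/-- Local frames in coordinates. -/
theorem IsSmoothBigSubbundle.exists_smoothNear {k : ℕ}
    {E : ∀ x : M, Submodule ℝ (BigTangent V x)} (hE : IsSmoothBigSubbundle k E) (y : M) :
    ∃ A : V → (Fin k → ℝ) →L[ℝ] Big V, SmoothNear A (extChartAt 𝓘(ℝ, V) y y) ∧
      ∀ᶠ v in 𝓝 (extChartAt 𝓘(ℝ, V) y y), Function.Injective (A v) ∧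
        LinearMap.range (A v).toLinearMap = pullbackField (W := V) (chartInv V y) E v := by
  obtain ⟨U, hU, hyU, s, hs, hsE⟩ := hE y
  refine ⟨fun v => ∑ i, (ContinuousLinearMap.proj (R := ℝ) (φ := fun _ : Fin k => ℝ) i).smulRight
    (chartSection y (s i) v), ?_, ?_⟩
  · exact .sum_smulRight fun i => smoothNear_chartSection (hU.mem_nhds hyU) (hs i)
  · filter_upwards [eventually_chartInv (hU.mem_nhds hyU), extChartAt_target_mem_nhds_self y]
      with v hv1 hv2
    have h1 := hsE _ hv1
    have h2 : LinearIndependent ℝ fun i => chartSection y (s i) v := by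
      simp only [chartSection_eq hv2, chartCoord_eq_fiberCoord]
      exact h1.1.map' _ (LinearMap.ker_eq_bot.2
        (fiberCoord_injective ((extChartAt 𝓘(ℝ, V) y).map_target hv2)))
    have h3 : ∀ c : Fin k → ℝ, (∑ i, (ContinuousLinearMap.proj (R := ℝ)
        (φ := fun _ : Fin k => ℝ) i).smulRight (chartSection y (s i) v)) c =
        ∑ i, c i • chartSection y (s i) v := by
      intro c
      simp
    constructor
    · intro c c' hc
      rw [h3, h3] at hc
      have h4 := Fintype.linearIndependent_iff.1 h2 (c - c') (by
        simp only [Pi.sub_apply, sub_smul, Finset.sum_sub_distrib, hc, sub_self])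
      ext i
      simpa [sub_eq_zero] using h4 i
    · rw [← map_fiberCoord hv2, ← h1.2, Submodule.map_span, ← Set.range_comp]
      ext u
      rw [Submodule.mem_span_range_iff_exists_fun]
      refine exists_congr fun c => ?_
      refine iff_of_eq (congrArg (· = u) ((h3 c).trans (Finset.sum_congr rfl fun i _ => ?_)))
      rw [chartSection_eq hv2, chartCoord_eq_fiberCoord]
      rfl

/-- Smooth parametrisations in coordinates give local frames. -/
theorem isSmoothBigSubbundle_of_smoothNear {k : ℕ}
    {E : ∀ x : M, Submodule ℝ (BigTangent V x)}
    (h : ∀ y : M, ∃ A : V → (Fin k → ℝ) →L[ℝ] Big V, SmoothNear A (extChartAt 𝓘(ℝ, V) y y) ∧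
      ∀ᶠ v in 𝓝 (extChartAt 𝓘(ℝ, V) y y), Function.Injective (A v) ∧
        LinearMap.range (A v).toLinearMap = pullbackField (W := V) (chartInv V y) E v) :
    IsSmoothBigSubbundle k E := by
  intro y
  obtain ⟨A, hA, hAE⟩ := h y
  let s : Fin k → V → Big V := fun i v => A v (Pi.single i 1)
  have hs : ∀ i, SmoothNear (s i) (extChartAt 𝓘(ℝ, V) y y) := fun i => hA.clm_apply (.const _)
  choose U hU hyU hσ using fun i => exists_isSmoothBigSectionOn_sectionOfChart (hs i)
  have h1 := (continuousAt_extChartAt (I := 𝓘(ℝ, V)) y).eventually hAE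
  have h2 : (⋂ i, U i) ∈ 𝓝 y := Filter.iInter_mem.2 fun i => (hU i).mem_nhds (hyU i)
  obtain ⟨O, hOU, hO, hyO⟩ := mem_nhds_iff.1
    (inter_mem h2 (inter_mem h1 (extChartAt_source_mem_nhds (I := 𝓘(ℝ, V)) y)))
  refine ⟨O, hO, hyO, fun i => sectionOfChart y (s i), fun i =>
    ⟨(hσ i).1.mono fun x hx => Set.mem_iInter.1 (hOU hx).1 i,
      (hσ i).2.mono fun x hx => Set.mem_iInter.1 (hOU hx).1 i⟩, fun x hx => ?_⟩
  obtain ⟨-, ⟨h3, h4⟩, hxs⟩ := hOU hx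
  obtain ⟨v, hv, rfl⟩ : ∃ v ∈ (extChartAt 𝓘(ℝ, V) y).target, chartInv V y v = x :=
    ⟨_, (extChartAt 𝓘(ℝ, V) y).map_source hxs, (extChartAt 𝓘(ℝ, V) y).left_inv hxs⟩
  rw [(extChartAt 𝓘(ℝ, V) y).right_inv hv] at h3 h4
  have hinj := fiberCoord_injective (V := V) ((extChartAt 𝓘(ℝ, V) y).map_target hv)
  have h5 : ∀ i, fiberCoord y (chartInv V y v) (sectionOfChart y (s i) (chartInv V y v)) =
      A v (Pi.single i 1) := by
    intro i
    rw [← chartCoord_eq_fiberCoord, ← chartSection_eq hv, chartSection_sectionOfChart hv]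
  have h6 : ((A v).toLinearMap ∘ fun i => Pi.single i 1) =
      (fiberCoord y (chartInv V y v)) ∘ fun i => sectionOfChart y (s i) (chartInv V y v) := by
    funext i; exact (h5 i).symm
  constructor
  · refine LinearIndependent.of_comp (fiberCoord y (chartInv V y v)) ?_
    rw [← h6]
    exact (Pi.linearIndependent_single_one (Fin k) ℝ).map' _ (LinearMap.ker_eq_bot.2 h3)
  · apply Submodule.map_injective_of_injective hinj
    rw [map_fiberCoord hv, ← h4, Submodule.map_span, ← Set.range_comp, ← h6, Set.range_comp,
      ← Submodule.map_span]
    have : Submodule.span ℝ (Set.range fun i : Fin k => (Pi.single i 1 : Fin k → ℝ)) = ⊤ := by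
      rw [← (Pi.basisFun ℝ (Fin k)).span_eq]
      congr 2
      funext i
      simp
    rw [this, Submodule.map_top]

end ChartCoordinates

/-! ### Functoriality and locality of pullback fields. -/

section Functoriality

variable {V W U : Type*} [NormedAddCommGroup V] [NormedSpace ℝ V]
  [NormedAddCommGroup W] [NormedSpace ℝ W] [NormedAddCommGroup U] [NormedSpace ℝ U]
  {M : Type*} [TopologicalSpace M] [ChartedSpace V M]
  {N : Type*} [TopologicalSpace N] [ChartedSpace W N]
  {P : Type*} [TopologicalSpace P] [ChartedSpace U P]

theorem pullbackField_comp {f : N → M} {g : P → N} {x : P}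
    (hf : MDifferentiableAt 𝓘(ℝ, W) 𝓘(ℝ, V) f (g x))
    (hg : MDifferentiableAt 𝓘(ℝ, U) 𝓘(ℝ, W) g x) (E : ∀ y : M, Submodule ℝ (BigTangent V y)) :
    pullbackField (W := U) (f ∘ g) E x =
      pullbackField (W := U) g (pullbackField (W := W) f E) x := by
  have h : mfderiv 𝓘(ℝ, U) 𝓘(ℝ, V) (f ∘ g) x =
      (mfderiv 𝓘(ℝ, W) 𝓘(ℝ, V) f (g x)).comp (mfderiv 𝓘(ℝ, U) 𝓘(ℝ, W) g x) :=
    mfderiv_comp x hf hg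
  exact (congrArg (fun l => bigPullback l (E (f (g x)))) h).trans (bigPullback_comp _ _ _)

theorem pullbackField_congr {f g : N → M} {x : N} (h : f =ᶠ[𝓝 x] g)
    (E : ∀ y : M, Submodule ℝ (BigTangent V y)) :
    pullbackField (W := W) f E x = pullbackField (W := W) g E x := by
  let E' : M → Submodule ℝ (Big V) := fun y => E y
  have h1 : mfderiv 𝓘(ℝ, W) 𝓘(ℝ, V) f x = mfderiv 𝓘(ℝ, W) 𝓘(ℝ, V) g x := h.mfderiv_eq
  have h2 : E' (f x) = E' (g x) := congrArg E' h.eq_of_nhds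
  exact congrArg₂ (fun (l : TangentSpace 𝓘(ℝ, W) x →L[ℝ] V) (L : Submodule ℝ (Big V)) =>
    bigPullback l L) h1 h2

end Functoriality

/-! ### Pullbacks along parametrised submanifolds. -/

section Parametrization

variable {V W : Type*} [NormedAddCommGroup V] [NormedSpace ℝ V]
  [NormedAddCommGroup W] [NormedSpace ℝ W]
  {M : Type*} [TopologicalSpace M] [ChartedSpace V M] [IsManifold 𝓘(ℝ, V) ∞ M]

theorem smoothNear_of_contMDiffAt {f : W → V} {u : W}
    (h : ∀ᶠ w in 𝓝 u, ContMDiffAt 𝓘(ℝ, W) 𝓘(ℝ, V) ∞ f w) : SmoothNear f u :=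
  h.mono fun _ hw => contMDiffAt_iff_contDiffAt.1 hw

theorem smoothNear_extChartAt_comp {f : W → M} {u : W}
    (hf : ∀ᶠ w in 𝓝 u, ContMDiffAt 𝓘(ℝ, W) 𝓘(ℝ, V) ∞ f w) :
    SmoothNear (fun w => extChartAt 𝓘(ℝ, V) (f u) (f w)) u := by
  refine smoothNear_of_contMDiffAt ?_
  filter_upwards [hf, hf.self_of_nhds.continuousAt.eventually
    (extChartAt_source_mem_nhds (I := 𝓘(ℝ, V)) (f u))] with w h1 h2
  rw [extChartAt_source] at h2
  exact (contMDiffAt_extChartAt' h2).comp w h1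

theorem map_fiberCoord_of_mem {y x : M} (hx : x ∈ (extChartAt 𝓘(ℝ, V) y).source)
    (E : ∀ x : M, Submodule ℝ (BigTangent V x)) :
    (E x).map (fiberCoord y x) =
      pullbackField (W := V) (chartInv V y) E (extChartAt 𝓘(ℝ, V) y x) := by
  obtain ⟨v, hv, rfl⟩ : ∃ v ∈ (extChartAt 𝓘(ℝ, V) y).target, chartInv V y v = x :=
    ⟨_, (extChartAt 𝓘(ℝ, V) y).map_source hx, (extChartAt 𝓘(ℝ, V) y).left_inv hx⟩
  rw [(extChartAt 𝓘(ℝ, V) y).right_inv hv]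
  exact map_fiberCoord hv E

/-- Reduces pullbacks to a manifold-valued `f` to the case of a map between normed spaces, by
inserting the preferred chart at `f u`. -/
theorem eventually_pullbackField_eq {f : W → M} {u : W}
    (hf : ∀ᶠ w in 𝓝 u, ContMDiffAt 𝓘(ℝ, W) 𝓘(ℝ, V) ∞ f w)
    (E : ∀ x : M, Submodule ℝ (BigTangent V x)) :
    ∀ᶠ w in 𝓝 u, (pullbackField (W := W) f E w : Submodule ℝ (Big W)) =
      bigPullback (fderiv ℝ (fun w => extChartAt 𝓘(ℝ, V) (f u) (f w)) w)
        (pullbackField (W := V) (chartInv V (f u)) E (extChartAt 𝓘(ℝ, V) (f u) (f w)) :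
          Submodule ℝ (Big V)) := by
  have hs := hf.self_of_nhds.continuousAt.eventually
    (extChartAt_source_mem_nhds (I := 𝓘(ℝ, V)) (f u))
  filter_upwards [smoothNear_extChartAt_comp hf, hs.eventually_nhds] with w h1 h2
  have h3 : f =ᶠ[𝓝 w] chartInv V (f u) ∘ fun w => extChartAt 𝓘(ℝ, V) (f u) (f w) :=
    h2.mono fun x hx => ((extChartAt 𝓘(ℝ, V) (f u)).left_inv hx).symm
  have h4 : pullbackField (W := W) f E w = _ := pullbackField_congr h3 E
  have h5 := (mdifferentiableAt_chartInv
    ((extChartAt 𝓘(ℝ, V) (f u)).map_source h2.self_of_nhds))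
  have h6 := (h1.differentiableAt (by simp)).mdifferentiableAt
  refine h4.trans ((pullbackField_comp (W := V) (U := W)
    (g := fun w => extChartAt 𝓘(ℝ, V) (f u) (f w)) h5 h6 E).trans ?_)
  unfold pullbackField
  exact congrArg (fun l : W →L[ℝ] V => bigPullback l
    (pullbackField (W := V) (chartInv V (f u)) E (extChartAt 𝓘(ℝ, V) (f u) (f w)) :
          Submodule ℝ (Big V))) mfderiv_eq_fderiv

theorem eventually_finrank_tangentialPart_eq {f : W → M} {u : W}
    (hf : ∀ᶠ w in 𝓝 u, ContMDiffAt 𝓘(ℝ, W) 𝓘(ℝ, V) ∞ f w)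
    (E : ∀ x : M, Submodule ℝ (BigTangent V x)) :
    ∀ᶠ w in 𝓝 u, Module.finrank ℝ ((pullbackField (W := V) (chartInv V (f u)) E
        (extChartAt 𝓘(ℝ, V) (f u) (f w)) : Submodule ℝ (Big V)) ⊓
      (LinearMap.range (fderiv ℝ (fun w => extChartAt 𝓘(ℝ, V) (f u) (f w)) w).toLinearMap).prod ⊤ :
        Submodule ℝ (Big V)) = Module.finrank ℝ (tangentialPart (W := W) f E w) := by
  have hs := hf.self_of_nhds.continuousAt.eventually
    (extChartAt_source_mem_nhds (I := 𝓘(ℝ, V)) (f u))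
  filter_upwards [hf, hs] with w h1 h2
  have hinj := fiberCoord_injective (V := V) h2
  have h := isInvertible_mfderiv_extChartAt (I := 𝓘(ℝ, V)) h2
  have h3 : fderiv ℝ (fun w => extChartAt 𝓘(ℝ, V) (f u) (f w)) w =
      (mfderiv 𝓘(ℝ, V) 𝓘(ℝ, V) (extChartAt 𝓘(ℝ, V) (f u)) (f w)).comp
        (mfderiv 𝓘(ℝ, W) 𝓘(ℝ, V) f w) :=
    mfderiv_eq_fderiv.symm.trans (mfderiv_comp w
      (mdifferentiableAt_extChartAt (by rwa [extChartAt_source] at h2))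
      (h1.mdifferentiableAt (by simp)))
  have h4 : (tangentialPart (W := W) f E w).map (fiberCoord (f u) (f w)) =
      (pullbackField (W := V) (chartInv V (f u)) E
        (extChartAt 𝓘(ℝ, V) (f u) (f w)) : Submodule ℝ (Big V)) ⊓
      (LinearMap.range (fderiv ℝ (fun w => extChartAt 𝓘(ℝ, V) (f u) (f w)) w).toLinearMap).prod
        ⊤ := by
    unfold tangentialPart
    rw [Submodule.map_inf _ hinj, map_fiberCoord_of_mem h2]
    refine congrArg _ ?_
    ext z
    constructor
    · rintro ⟨a, ⟨⟨X, hX⟩, -⟩, rfl⟩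
      exact ⟨⟨X, (DFunLike.congr_fun h3 X).trans (congrArg _ hX)⟩, trivial⟩
    · rintro ⟨⟨X, hX⟩, -⟩
      refine ⟨(mfderiv 𝓘(ℝ, W) 𝓘(ℝ, V) f w X,
        z.2.comp (mfderiv 𝓘(ℝ, V) 𝓘(ℝ, V) (extChartAt 𝓘(ℝ, V) (f u)) (f w))),
        ⟨⟨X, rfl⟩, trivial⟩, Prod.ext ?_ ?_⟩
      · exact (DFunLike.congr_fun h3 X).symm.trans hX
      · exact ContinuousLinearMap.ext fun Y => congrArg z.2 (h.self_apply_inverse Y)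
  exact (congrArg (fun L : Submodule ℝ (Big V) => Module.finrank ℝ L) h4).symm.trans
    (Submodule.equivMapOfInjective _ hinj _).finrank_eq.symm

variable [FiniteDimensional ℝ V] [FiniteDimensional ℝ W] {f : W → M} {u : W} {ρ : V → W}
  {k d r : ℕ} {E : ∀ x : M, Submodule ℝ (BigTangent V x)}

/-- The pullback along an immersed parametrisation has a normalised smooth frame. -/
theorem exists_frame_pullbackField (hE : IsSmoothBigSubbundle k E)
    (hf : ∀ᶠ w in 𝓝 u, ContMDiffAt 𝓘(ℝ, W) 𝓘(ℝ, V) ∞ f w)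
    (hρ : SmoothNear ρ (extChartAt 𝓘(ℝ, V) (f u) (f u)))
    (hρf : ∀ᶠ w in 𝓝 u, ρ (extChartAt 𝓘(ℝ, V) (f u) (f w)) = w)
    (hd : ∀ᶠ w in 𝓝 u, Module.finrank ℝ (tangentialPart (W := W) f E w) = d)
    (hr : ∀ᶠ w in 𝓝 u, Module.finrank ℝ (pullbackField (W := W) f E w) = r) :
    ∃ (B : Big W →L[ℝ] (Fin r → ℝ)) (C : W → (Fin r → ℝ) →L[ℝ] Big W), SmoothNear C u ∧
      ∀ᶠ w in 𝓝 u, (∀ c, B (C w c) = c) ∧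
        LinearMap.range (C w).toLinearMap = (pullbackField (W := W) f E w) := by
  obtain ⟨A, hA, hAE⟩ := hE.exists_smoothNear (f u)
  have hL := eventually_pullbackField_eq hf E
  have hT := eventually_finrank_tangentialPart_eq hf E
  obtain ⟨B, C, D, hC, -, h⟩ := exists_frame_bigPullback (smoothNear_extChartAt_comp hf) hρ hρf hA
    (hAE.mono fun _ h => h.1)
    (E := fun v => pullbackField (W := V) (chartInv V (f u)) E v) (hAE.mono fun _ h => h.2)
    (d := d) (r := r) (by filter_upwards [hT, hd] with w h1 h2 using h1.trans h2)
    (by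
      filter_upwards [hL, hr] with w h1 h2
      exact (congrArg (fun L : Submodule ℝ (Big W) => Module.finrank ℝ L) h1).symm.trans h2)
  refine ⟨B, C, hC, ?_⟩
  filter_upwards [h, hL] with w h1 h2
  exact ⟨h1.1, h1.2.1.trans h2.symm⟩

/-- Integrability of the pullback along an immersed parametrisation. -/
theorem flatBracket_mem_pullbackField [T2Space M] (hE : IsSmoothBigSubbundle k E)
    (hEint : IsCourantClosed E)
    (hf : ∀ᶠ w in 𝓝 u, ContMDiffAt 𝓘(ℝ, W) 𝓘(ℝ, V) ∞ f w)
    (hρ : SmoothNear ρ (extChartAt 𝓘(ℝ, V) (f u) (f u)))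
    (hρf : ∀ᶠ w in 𝓝 u, ρ (extChartAt 𝓘(ℝ, V) (f u) (f w)) = w)
    (hd : ∀ᶠ w in 𝓝 u, Module.finrank ℝ (tangentialPart (W := W) f E w) = d)
    (hr : ∀ᶠ w in 𝓝 u, Module.finrank ℝ (pullbackField (W := W) f E w) = r)
    {s t : W → Big W} (hs : SmoothNear s u) (ht : SmoothNear t u)
    (hsE : ∀ᶠ w in 𝓝 u, s w ∈ (pullbackField (W := W) f E w : Submodule ℝ (Big W)))
    (htE : ∀ᶠ w in 𝓝 u, t w ∈ (pullbackField (W := W) f E w : Submodule ℝ (Big W))) :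
    flatBracket s t u ∈ (pullbackField (W := W) f E u : Submodule ℝ (Big W)) := by
  obtain ⟨A, hA, hAE⟩ := hE.exists_smoothNear (f u)
  have hL := eventually_pullbackField_eq hf E
  have hT := eventually_finrank_tangentialPart_eq hf E
  have hj := smoothNear_extChartAt_comp hf
  have key : ∀ s : W → Big W, SmoothNear s u →
      (∀ᶠ w in 𝓝 u, s w ∈ (pullbackField (W := W) f E w : Submodule ℝ (Big W))) →
      ∃ S : V → Big V, SmoothNear S (extChartAt 𝓘(ℝ, V) (f u) (f u)) ∧
        (∀ᶠ v in 𝓝 (extChartAt 𝓘(ℝ, V) (f u) (f u)),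
          S v ∈ pullbackField (W := V) (chartInv V (f u)) E v) ∧
        ∀ᶠ w in 𝓝 u, BigRelated (fun w => extChartAt 𝓘(ℝ, V) (f u) (f w)) s S w := by
    intro s hs hsE
    refine exists_related_lift hj hρ hρf hA (hAE.mono fun _ h => h.1)
      (E := fun v => pullbackField (W := V) (chartInv V (f u)) E v) (hAE.mono fun _ h => h.2)
      (d := d) (r := r) (by filter_upwards [hT, hd] with w h1 h2 using h1.trans h2) ?_ hs ?_
    · filter_upwards [hL, hr] with w h1 h2
      exact (congrArg (fun L : Submodule ℝ (Big W) => Module.finrank ℝ L) h1).symm.trans h2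
    · filter_upwards [hL, hsE] with w h1 h2
      exact h1.le h2
  obtain ⟨S, hS, hSE, hsS⟩ := key s hs hsE
  obtain ⟨T, hT, hTE, htT⟩ := key t ht htE
  have h1 := hEint.flatBracket_mem hS hT hSE hTE
  have h2 := BigRelated.flatBracket hj.contDiffAt hs.differentiableAt ht.differentiableAt
    hS.differentiableAt hT.differentiableAt hsS htT
  refine hL.self_of_nhds.ge ⟨_, ?_, h2.2⟩
  rw [← h2.1]
  exact h1

end Parametrization

/-! ### Normal forms of immersions and submersions. -/

section AdaptedCharts

variable {V W Z : Type*} [NormedAddCommGroup V] [NormedSpace ℝ V]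
  [NormedAddCommGroup W] [NormedSpace ℝ W] [NormedAddCommGroup Z] [NormedSpace ℝ Z]
  {M : Type*} [TopologicalSpace M] [ChartedSpace V M] [IsManifold 𝓘(ℝ, V) ∞ M]
  {N : Type*} [TopologicalSpace N] [ChartedSpace W N]
  {Q : Type*} [TopologicalSpace Q] [ChartedSpace Z Q]

omit [IsManifold 𝓘(ℝ, V) ∞ M] in
theorem mdifferentiable_of_mem_maximalAtlas {φ : OpenPartialHomeomorph M V}
    (hφ : φ ∈ IsManifold.maximalAtlas 𝓘(ℝ, V) ∞ M) : φ.MDifferentiable 𝓘(ℝ, V) 𝓘(ℝ, V) :=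
  ⟨(contMDiffOn_of_mem_maximalAtlas hφ).mdifferentiableOn (by simp),
    (contMDiffOn_symm_of_mem_maximalAtlas hφ).mdifferentiableOn (by simp)⟩

theorem eventually_contMDiffAt_chartInv (y : M) :
    ∀ᶠ v in 𝓝 (extChartAt 𝓘(ℝ, V) y y),
      ContMDiffAt 𝓘(ℝ, V) 𝓘(ℝ, V) ∞ (chartInv V y) v := by
  filter_upwards [extChartAt_target_mem_nhds_self (V := V) y] with v hv
  exact contMDiffAt_chartInv hv

/-- In charts, an immersion has a smooth left inverse. -/
theorem Manifold.IsImmersion.exists_smooth_leftInverse {ι : N → M}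
    (hι : IsImmersion 𝓘(ℝ, W) 𝓘(ℝ, V) ∞ ι) {φ : OpenPartialHomeomorph N W}
    (hφ : φ ∈ IsManifold.maximalAtlas 𝓘(ℝ, W) ∞ N) {u : W} (hu : u ∈ φ.target) :
    ∃ ρ : V → W, SmoothNear ρ (extChartAt 𝓘(ℝ, V) (ι (φ.symm u)) (ι (φ.symm u))) ∧
      ∀ᶠ w in 𝓝 u, ρ (extChartAt 𝓘(ℝ, V) (ι (φ.symm u)) (ι (φ.symm w))) = w := by
  set x := φ.symm u
  set y := ι x
  have hx : x ∈ φ.source := φ.map_target hu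
  have h := hι.isImmersionAt x
  -- In the normal form `w ↦ (w, 0)` the first component is a left inverse. It returns coordinates
  -- in `h.domChart`, which are converted below to coordinates in `φ`.
  have hw : ∀ x' ∈ h.domChart.source, (h.equiv.symm (h.codChart (ι x'))).1 = h.domChart x' := by
    intro x' hx'
    have h1 := h.writtenInCharts (show h.domChart x' ∈ (h.domChart.extend 𝓘(ℝ, W)).target by
      simpa using h.domChart.map_source hx')
    simp only [Function.comp_apply, OpenPartialHomeomorph.extend_coe,
      OpenPartialHomeomorph.extend_coe_symm, modelWithCornersSelf_coe,
      modelWithCornersSelf_coe_symm, id] at h1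
    rw [h.domChart.left_inv hx'] at h1
    rw [h1, ContinuousLinearEquiv.symm_apply_apply]
  have hy : chartInv V y (extChartAt 𝓘(ℝ, V) y y) = y := chartInv_extChartAt y
  have hcod : y ∈ h.codChart.source := h.mem_codChart_source
  let g : V → W := fun v => (h.equiv.symm (h.codChart (chartInv V y v))).1
  have hg : SmoothNear g (extChartAt 𝓘(ℝ, V) y y) := by
    have h1 : SmoothNear (fun v => h.codChart (chartInv V y v)) (extChartAt 𝓘(ℝ, V) y y) := by
      refine smoothNear_of_contMDiffAt ?_
      filter_upwards [eventually_contMDiffAt_chartInv (V := V) y,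
        eventually_chartInv (V := V) (h.codChart.open_source.mem_nhds hcod)] with v h1 h2
      exact (contMDiffAt_of_mem_maximalAtlas h.codChart_mem_maximalAtlas h2).comp v h1
    exact ((SmoothNear.clm (h.equiv.symm : V →L[ℝ] W × h.complement)).comp h1).fst
  have hg0 : g (extChartAt 𝓘(ℝ, V) y y) = h.domChart x := by
    simp only [g, hy]
    exact hw x h.mem_domChart_source
  have htgt : h.domChart x ∈ h.domChart.target := h.domChart.map_source h.mem_domChart_source
  have hτ : SmoothNear (fun v => φ (h.domChart.symm v)) (g (extChartAt 𝓘(ℝ, V) y y)) := by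
    rw [hg0]
    refine smoothNear_of_contMDiffAt ?_
    have h1 : ∀ᶠ v in 𝓝 (h.domChart x), h.domChart.symm v ∈ φ.source :=
      (h.domChart.continuousAt_symm htgt).eventually (φ.open_source.mem_nhds
        (by rwa [h.domChart.left_inv h.mem_domChart_source]))
    filter_upwards [h1, h.domChart.open_target.mem_nhds htgt] with v h1 h2
    exact (contMDiffAt_of_mem_maximalAtlas hφ h1).comp v
      (contMDiffAt_symm_of_mem_maximalAtlas h.domChart_mem_maximalAtlas h2)
  refine ⟨fun v => φ (h.domChart.symm (g v)), hτ.comp hg, ?_⟩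
  have hcont : ContinuousAt φ.symm u := φ.continuousAt_symm hu
  have hιc : ContinuousAt ι x := h.contMDiffAt.continuousAt
  filter_upwards [φ.open_target.mem_nhds hu,
    hcont.eventually (h.domChart.open_source.mem_nhds h.mem_domChart_source),
    hcont.eventually (hιc.eventually (extChartAt_source_mem_nhds (I := 𝓘(ℝ, V)) y))]
    with w h1 h2 h3
  have h4 : chartInv V y (extChartAt 𝓘(ℝ, V) y (ι (φ.symm w))) = ι (φ.symm w) :=
    (extChartAt 𝓘(ℝ, V) y).left_inv h3
  simp only [g, h4]
  rw [hw _ h2, h.domChart.left_inv h2, φ.right_inv h1]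

/-- Around each point, a submersion is a linear projection in suitable charts. -/
theorem Manifold.IsSubmersion.exists_adapted_chart [IsManifold 𝓘(ℝ, Z) ∞ Q] {π : N → Q}
    (hπ : IsSubmersion 𝓘(ℝ, W) 𝓘(ℝ, Z) ∞ π) (x : N) :
    ∃ φ ∈ IsManifold.maximalAtlas 𝓘(ℝ, W) ∞ N, ∃ u ∈ φ.target, φ.symm u = x ∧
      ∃ (q : W →L[ℝ] Z) (g : Z → Q) (m : Z → W),
      (∀ w ∈ φ.target, π (φ.symm w) = g (q w) ∧
        MDifferentiableAt 𝓘(ℝ, Z) 𝓘(ℝ, Z) g (q w)) ∧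
      (∀ w ∈ φ.target, ∀ w' ∈ φ.target, π (φ.symm w) = π (φ.symm w') → q w = q w') ∧
      SmoothNear m (extChartAt 𝓘(ℝ, Z) (π x) (π x)) ∧
      m (extChartAt 𝓘(ℝ, Z) (π x) (π x)) = u ∧
      ∀ᶠ z in 𝓝 (extChartAt 𝓘(ℝ, Z) (π x) (π x)), π (φ.symm (m z)) = chartInv Z (π x) z := by
  have h := hπ.isSubmersionAt x
  let q : W →L[ℝ] Z := (ContinuousLinearMap.fst ℝ Z h.complement).comp
    (h.equiv : W →L[ℝ] Z × h.complement)
  let T : Z →L[ℝ] W := (h.equiv.symm : Z × h.complement →L[ℝ] W).comp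
    (ContinuousLinearMap.inl ℝ Z h.complement)
  have hqT : ∀ z, q (T z) = z := by simp [q, T]
  have hw : ∀ w ∈ h.domChart.target, h.codChart (π (h.domChart.symm w)) = q w := by
    intro w hw
    have h1 := h.writtenInCharts (show w ∈ (h.domChart.extend 𝓘(ℝ, W)).target by
      simpa using hw)
    have h2 : h.codChart (π (h.domChart.symm w)) = (h.equiv w).1 := by simpa using h1
    exact h2
  have hsrc : ∀ w ∈ h.domChart.target, π (h.domChart.symm w) ∈ h.codChart.source := fun w hw =>
    h.source_subset_preimage_source (h.domChart.map_target hw)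
  have hxs := h.mem_domChart_source
  have hqx : q (h.domChart x) = h.codChart (π x) := by
    rw [← hw _ (h.domChart.map_source hxs), h.domChart.left_inv hxs]
  have hz0 : chartInv Z (π x) (extChartAt 𝓘(ℝ, Z) (π x) (π x)) = π x := chartInv_extChartAt _
  -- A section of `q` up to the change of chart on `Q`, translated so as to pass through `h.domChart
  -- x`; the translation vector lies in `ker q`.
  let m : Z → W := fun z => T (h.codChart (chartInv Z (π x) z)) +
    (h.domChart x - T (h.codChart (π x)))
  have hm0 : m (extChartAt 𝓘(ℝ, Z) (π x) (π x)) = h.domChart x := by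
    simp only [m, hz0]
    abel
  have hqm : ∀ z, q (m z) = h.codChart (chartInv Z (π x) z) := by
    intro z
    simp only [m, map_add, map_sub, hqT, hqx, sub_self, add_zero]
  have hcs := eventually_chartInv (V := Z) (h.codChart.open_source.mem_nhds h.mem_codChart_source)
  have hm : SmoothNear m (extChartAt 𝓘(ℝ, Z) (π x) (π x)) := by
    have h1 : SmoothNear (fun z => h.codChart (chartInv Z (π x) z))
        (extChartAt 𝓘(ℝ, Z) (π x) (π x)) := by
      refine smoothNear_of_contMDiffAt ?_
      filter_upwards [eventually_contMDiffAt_chartInv (V := Z) (π x), hcs] with v h1 h2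
      exact (contMDiffAt_of_mem_maximalAtlas h.codChart_mem_maximalAtlas h2).comp v h1
    exact ((SmoothNear.clm T).comp h1).add (.const _)
  refine ⟨h.domChart, h.domChart_mem_maximalAtlas, h.domChart x, h.domChart.map_source hxs,
    h.domChart.left_inv hxs, q, h.codChart.symm, m,
    fun w hw' => ⟨?_, ?_⟩, fun w h1 w' h2 h3 => ?_, hm, hm0, ?_⟩
  · rw [← hw w hw', h.codChart.left_inv (hsrc w hw')]
  · rw [← hw w hw']
    exact (mdifferentiable_of_mem_maximalAtlas h.codChart_mem_maximalAtlas).mdifferentiableAt_symm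
      (h.codChart.map_source (hsrc w hw'))
  · rw [← hw w h1, ← hw w' h2, h3]
  · have h1 : ∀ᶠ z in 𝓝 (extChartAt 𝓘(ℝ, Z) (π x) (π x)), m z ∈ h.domChart.target :=
      hm.continuousAt.eventually (h.domChart.open_target.mem_nhds
        (by rw [hm0]; exact h.domChart.map_source hxs))
    filter_upwards [h1, hcs] with z h1 h2
    rw [← h.codChart.left_inv (hsrc _ h1), hw _ h1, hqm, h.codChart.left_inv h2]

end AdaptedCharts

/-! ### Integrability of the pullback to a submanifold. -/

section ChartIntegrable

variable {V W : Type*} [NormedAddCommGroup V] [NormedSpace ℝ V] [FiniteDimensional ℝ V]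
  [NormedAddCommGroup W] [NormedSpace ℝ W] [FiniteDimensional ℝ W]
  {M : Type*} [TopologicalSpace M] [ChartedSpace V M] [IsManifold 𝓘(ℝ, V) ∞ M]
  {N : Type*} [TopologicalSpace N] [ChartedSpace W N] [IsManifold 𝓘(ℝ, W) ∞ N]

/-- In every chart, the field of subspaces `L` has normalised smooth local frames of rank `r`, and
its local sections are closed under the bracket. -/
structure IsChartIntegrable (r : ℕ) (L : ∀ x : N, Submodule ℝ (BigTangent W x)) : Prop where
  -- The whole maximal atlas is allowed because charts in which `π` is linear need not be preferred
  -- charts.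
  frame : ∀ φ ∈ IsManifold.maximalAtlas 𝓘(ℝ, W) ∞ N, ∀ u ∈ φ.target,
    ∃ (B : Big W →L[ℝ] (Fin r → ℝ)) (C : W → (Fin r → ℝ) →L[ℝ] Big W), SmoothNear C u ∧
      ∀ᶠ w in 𝓝 u, (∀ c, B (C w c) = c) ∧
        LinearMap.range (C w).toLinearMap = (pullbackField (W := W) φ.symm L w)
  bracket : ∀ φ ∈ IsManifold.maximalAtlas 𝓘(ℝ, W) ∞ N, ∀ u ∈ φ.target, ∀ s t : W → Big W,
    SmoothNear s u → SmoothNear t u →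
    (∀ᶠ w in 𝓝 u, s w ∈ (pullbackField (W := W) φ.symm L w : Submodule ℝ (Big W))) →
    (∀ᶠ w in 𝓝 u, t w ∈ (pullbackField (W := W) φ.symm L w : Submodule ℝ (Big W))) →
    flatBracket s t u ∈ (pullbackField (W := W) φ.symm L u : Submodule ℝ (Big W))

omit [FiniteDimensional ℝ V] in
theorem IsSmoothBigSubbundle.finrank_eq {k : ℕ} {E : ∀ x : M, Submodule ℝ (BigTangent V x)}
    (hE : IsSmoothBigSubbundle k E) (y : M) : Module.finrank ℝ (E y) = k := by
  obtain ⟨U, -, hyU, s, -, h⟩ := hE y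
  rw [← (h y hyU).2, finrank_span_eq_card (h y hyU).1, Fintype.card_fin]

omit [FiniteDimensional ℝ V] [FiniteDimensional ℝ W] in
-- Obtained by differentiating the identity for the smooth left inverse.
theorem Manifold.IsImmersion.mfderiv_injective {ι : N → M} (hι : IsImmersion 𝓘(ℝ, W) 𝓘(ℝ, V) ∞ ι) (x : N) :
    Function.Injective (mfderiv 𝓘(ℝ, W) 𝓘(ℝ, V) ι x) := by
  obtain ⟨φ, hφ, u, hu, rfl⟩ : ∃ φ ∈ IsManifold.maximalAtlas 𝓘(ℝ, W) ∞ N, ∃ u ∈ φ.target,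
      φ.symm u = x :=
    ⟨chartAt W x, IsManifold.chart_mem_maximalAtlas x, chartAt W x x, mem_chart_target W x,
      (chartAt W x).left_inv (mem_chart_source W x)⟩
  have hφd := mdifferentiable_of_mem_maximalAtlas hφ
  have hιx := hι.isImmersionAt (φ.symm u)
  obtain ⟨ρ, hρ, hρj⟩ := IsImmersion.exists_smooth_leftInverse hι hφ hu
  have hιd : MDifferentiableAt 𝓘(ℝ, W) 𝓘(ℝ, V) ι (φ.symm u) :=
    hιx.contMDiffAt.mdifferentiableAt (by simp)
  have hs := hφd.mdifferentiableAt_symm hu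
  have hed : MDifferentiableAt 𝓘(ℝ, V) 𝓘(ℝ, V) (extChartAt 𝓘(ℝ, V) (ι (φ.symm u)))
      (ι (φ.symm u)) := mdifferentiableAt_extChartAt (mem_chart_source V _)
  have hρd := hρ.differentiableAt.mdifferentiableAt
  have hF : MDifferentiableAt 𝓘(ℝ, V) 𝓘(ℝ, W) (ρ ∘ extChartAt 𝓘(ℝ, V) (ι (φ.symm u)))
      (ι (φ.symm u)) := hρd.comp _ hed
  have h1 : mfderiv 𝓘(ℝ, W) 𝓘(ℝ, W) ((ρ ∘ extChartAt 𝓘(ℝ, V) (ι (φ.symm u))) ∘ ι ∘ φ.symm) u =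
      ContinuousLinearMap.id ℝ W :=
    (Filter.EventuallyEq.mfderiv_eq (hρj : _ =ᶠ[𝓝 u] id)).trans (mfderiv_id (I := 𝓘(ℝ, W)))
  have h2 := (mfderiv_comp u (g := ρ ∘ extChartAt 𝓘(ℝ, V) (ι (φ.symm u))) hF (hιd.comp u hs))
  have h3 := mfderiv_comp u hιd hs
  have h4 : ∀ a : W, mfderiv 𝓘(ℝ, V) 𝓘(ℝ, W) (ρ ∘ extChartAt 𝓘(ℝ, V) (ι (φ.symm u)))
      (ι (φ.symm u)) (mfderiv 𝓘(ℝ, W) 𝓘(ℝ, V) ι (φ.symm u)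
        (mfderiv 𝓘(ℝ, W) 𝓘(ℝ, W) φ.symm u a)) = a := by
    intro a
    refine Eq.trans ?_ (DFunLike.congr_fun h1 a)
    refine Eq.trans ?_ (DFunLike.congr_fun h2 a).symm
    exact congrArg _ (DFunLike.congr_fun h3 a).symm
  intro X X' hX
  obtain ⟨a, rfl⟩ := hφd.symm.mfderiv_surjective hu X
  obtain ⟨a', rfl⟩ := hφd.symm.mfderiv_surjective hu X'
  have h5 := congrArg (mfderiv 𝓘(ℝ, V) 𝓘(ℝ, W) (ρ ∘ extChartAt 𝓘(ℝ, V) (ι (φ.symm u)))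
      (ι (φ.symm u))) hX
  have h6 : a = a' := (h4 a).symm.trans (h5.trans (h4 a'))
  rw [h6]

theorem finrank_pullbackField {ι : N → M} (hι : IsImmersion 𝓘(ℝ, W) 𝓘(ℝ, V) ∞ ι)
    (E : ∀ y : M, Submodule ℝ (BigTangent V y)) (x : N) :
    Module.finrank ℝ (pullbackField (W := W) ι E x) + (Module.finrank ℝ (E (ι x)) +
      Module.finrank ℝ (tangentialPart (W := W) ι (bigOrthogonal E) x)) =
    Module.finrank ℝ (tangentialPart (W := W) ι E x) +
      (Module.finrank ℝ W + Module.finrank ℝ V) :=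
  finrank_bigPullback_of_injective (IsImmersion.mfderiv_injective hι x) (E (ι x))

/-- The pullback of an integrable structure to a submanifold is integrable, under the assumption
that the tangential parts have constant dimensions. -/
theorem exists_isChartIntegrable_pullbackField [T2Space M] {k d d' : ℕ}
    {E : ∀ x : M, Submodule ℝ (BigTangent V x)}
    (hE : IsSmoothBigSubbundle k E) (hEint : IsCourantClosed E) {ι : N → M}
    (hι : IsImmersion 𝓘(ℝ, W) 𝓘(ℝ, V) ∞ ι)
    (hd : ∀ x : N, Module.finrank ℝ (tangentialPart (W := W) ι E x) = d)
    (hd' : ∀ x : N, Module.finrank ℝ (tangentialPart (W := W) ι (bigOrthogonal E) x) = d') :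
    ∃ r, IsChartIntegrable r (pullbackField (W := W) ι E) := by
  -- By `finrank_pullbackField` the subtraction is exact as soon as `N` has a point; otherwise every
  -- claim about points of `N` is vacuous.
  set r := d + (Module.finrank ℝ W + Module.finrank ℝ V) - (k + d')
  have hr : ∀ x : N, Module.finrank ℝ (pullbackField (W := W) ι E x) = r := by
    intro x
    have := finrank_pullbackField hι E x
    rw [hd, hd', hE.finrank_eq] at this
    omega
  have hιd : ∀ x, ContMDiffAt 𝓘(ℝ, W) 𝓘(ℝ, V) ∞ ι x := fun x => (hι.isImmersionAt x).contMDiffAt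
  have hcomp : ∀ φ ∈ IsManifold.maximalAtlas 𝓘(ℝ, W) ∞ N, ∀ w ∈ φ.target,
      (pullbackField (W := W) (ι ∘ φ.symm) E w : Submodule ℝ (Big W)) =
        pullbackField (W := W) φ.symm (pullbackField (W := W) ι E) w := fun φ hφ w hw =>
    pullbackField_comp ((hιd _).mdifferentiableAt (by simp))
      ((mdifferentiable_of_mem_maximalAtlas hφ).mdifferentiableAt_symm hw) E
  have hsmooth : ∀ φ ∈ IsManifold.maximalAtlas 𝓘(ℝ, W) ∞ N, ∀ w ∈ φ.target,
      ContMDiffAt 𝓘(ℝ, W) 𝓘(ℝ, V) ∞ (ι ∘ φ.symm) w := fun φ hφ w hw =>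
    (hιd _).comp w (contMDiffAt_symm_of_mem_maximalAtlas hφ hw)
  have hdim : ∀ φ ∈ IsManifold.maximalAtlas 𝓘(ℝ, W) ∞ N, ∀ w ∈ φ.target,
      Module.finrank ℝ (pullbackField (W := W) (ι ∘ φ.symm) E w) = r ∧
      Module.finrank ℝ (tangentialPart (W := W) (ι ∘ φ.symm) E w) = d := by
    intro φ hφ w hw
    have hφd := mdifferentiable_of_mem_maximalAtlas hφ
    have hbij := hφd.symm.mfderiv_bijective hw
    have hιm : MDifferentiableAt 𝓘(ℝ, W) 𝓘(ℝ, V) ι (φ.symm w) :=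
      (hιd _).mdifferentiableAt (by simp)
    constructor
    · have h1 := finrank_bigPullback_of_surjective hbij.2
        (pullbackField (W := W) ι E (φ.symm w))
      have h2 := congrArg (fun L : Submodule ℝ (Big W) => Module.finrank ℝ L) (hcomp φ hφ w hw)
      rw [hr] at h1
      exact h2.trans (Nat.add_right_cancel h1)
    · rw [← hd (φ.symm w)]
      have h1 : LinearMap.range (mfderiv 𝓘(ℝ, W) 𝓘(ℝ, V) (ι ∘ φ.symm) w).toLinearMap =
          LinearMap.range (mfderiv 𝓘(ℝ, W) 𝓘(ℝ, V) ι (φ.symm w)).toLinearMap := by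
        have h2 := mfderiv_comp w hιm (hφd.mdifferentiableAt_symm hw)
        ext z
        constructor
        · rintro ⟨X, hX⟩
          exact ⟨_, (DFunLike.congr_fun h2 X).symm.trans hX⟩
        · rintro ⟨Y, hY⟩
          obtain ⟨X, rfl⟩ := hbij.2 Y
          exact ⟨X, (DFunLike.congr_fun h2 X).trans hY⟩
      unfold tangentialPart
      exact congrArg (fun R : Submodule ℝ V => Module.finrank ℝ
        ((E (ι (φ.symm w)) : Submodule ℝ (Big V)) ⊓ R.prod ⊤ : Submodule ℝ (Big V))) h1
  have htarget : ∀ (φ : OpenPartialHomeomorph N W), ∀ u ∈ φ.target, ∀ᶠ w in 𝓝 u, w ∈ φ.target :=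
    fun φ u hu => φ.open_target.mem_nhds hu
  refine ⟨r, ⟨fun φ hφ u hu => ?_, fun φ hφ u hu s t hs ht hsL htL => ?_⟩⟩
  · obtain ⟨ρ, hρ, hρj⟩ := IsImmersion.exists_smooth_leftInverse hι hφ hu
    obtain ⟨B, C, hC, h⟩ := exists_frame_pullbackField hE
      ((htarget φ u hu).mono (hsmooth φ hφ)) hρ hρj
      ((htarget φ u hu).mono fun w hw => (hdim φ hφ w hw).2)
      ((htarget φ u hu).mono fun w hw => (hdim φ hφ w hw).1)
    refine ⟨B, C, hC, ?_⟩
    filter_upwards [h, htarget φ u hu] with w h1 h2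
    exact ⟨h1.1, h1.2.trans (hcomp φ hφ w h2)⟩
  · obtain ⟨ρ, hρ, hρj⟩ := IsImmersion.exists_smooth_leftInverse hι hφ hu
    refine (hcomp φ hφ u hu).le (flatBracket_mem_pullbackField hE hEint
      ((htarget φ u hu).mono (hsmooth φ hφ)) hρ hρj
      ((htarget φ u hu).mono fun w hw => (hdim φ hφ w hw).2)
      ((htarget φ u hu).mono fun w hw => (hdim φ hφ w hw).1) hs ht ?_ ?_)
    · filter_upwards [hsL, htarget φ u hu] with w h1 h2
      exact (hcomp φ hφ w h2).ge h1
    · filter_upwards [htL, htarget φ u hu] with w h1 h2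
      exact (hcomp φ hφ w h2).ge h1

end ChartIntegrable

/-! ### Descent of the push-forward to the base. -/

section Reduction

variable {W Z : Type*}
  [NormedAddCommGroup W] [NormedSpace ℝ W]
  [NormedAddCommGroup Z] [NormedSpace ℝ Z]
  {N : Type*} [TopologicalSpace N] [ChartedSpace W N]
  {Q : Type*} [TopologicalSpace Q] [ChartedSpace Z Q] [IsManifold 𝓘(ℝ, Z) ∞ Q]
  {π : N → Q} {L : ∀ x : N, Submodule ℝ (BigTangent W x)} {r : ℕ}

omit [IsManifold 𝓘(ℝ, Z) ∞ Q] in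
theorem Manifold.IsSubmersion.mdifferentiableAt (hπ : IsSubmersion 𝓘(ℝ, W) 𝓘(ℝ, Z) ∞ π) (x : N) :
    MDifferentiableAt 𝓘(ℝ, W) 𝓘(ℝ, Z) π x :=
  (hπ.isSubmersionAt x).contMDiffAt.mdifferentiableAt (by simp)

/-- The right inverse is the derivative of a smooth local section of `π` through `x`. -/
theorem Manifold.IsSubmersion.exists_rightInverse_mfderiv (hπ : IsSubmersion 𝓘(ℝ, W) 𝓘(ℝ, Z) ∞ π) (x : N) :
    ∃ R : TangentSpace 𝓘(ℝ, Z) (π x) →L[ℝ] TangentSpace 𝓘(ℝ, W) x,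
      ∀ Y, mfderiv 𝓘(ℝ, W) 𝓘(ℝ, Z) π x (R Y) = Y := by
  obtain ⟨φ, hφ, u, hu, rfl, q, g, m, -, -, hm, hm0, hπm⟩ :=
    IsSubmersion.exists_adapted_chart hπ x
  set z₀ := extChartAt 𝓘(ℝ, Z) (π (φ.symm u)) (π (φ.symm u))
  have hmd : MDifferentiableAt 𝓘(ℝ, Z) 𝓘(ℝ, W) m z₀ := hm.differentiableAt.mdifferentiableAt
  have hs : MDifferentiableAt 𝓘(ℝ, W) 𝓘(ℝ, W) φ.symm u :=
    (mdifferentiable_of_mem_maximalAtlas hφ).mdifferentiableAt_symm hu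
  have hf : MDifferentiableAt 𝓘(ℝ, W) 𝓘(ℝ, Z) (π ∘ φ.symm) u :=
    (IsSubmersion.mdifferentiableAt hπ _).comp u hs
  have h0 : mfderiv 𝓘(ℝ, Z) 𝓘(ℝ, Z) ((π ∘ φ.symm) ∘ m) z₀ = ContinuousLinearMap.id ℝ Z := by
    have h1 : mfderiv 𝓘(ℝ, Z) 𝓘(ℝ, Z) ((π ∘ φ.symm) ∘ m) z₀ =
        mfderiv 𝓘(ℝ, Z) 𝓘(ℝ, Z) (chartInv Z (π (φ.symm u))) z₀ :=
      Filter.EventuallyEq.mfderiv_eq hπm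
    have h2 := mfderivWithin_range_extChartAt_symm (I := 𝓘(ℝ, Z)) (x := π (φ.symm u))
    rw [ModelWithCorners.range_eq_univ, mfderivWithin_univ] at h2
    exact h1.trans h2
  have h1 : mfderiv 𝓘(ℝ, Z) 𝓘(ℝ, Z) ((π ∘ φ.symm) ∘ m) z₀ =
      (mfderiv 𝓘(ℝ, W) 𝓘(ℝ, Z) (π ∘ φ.symm) u).comp (mfderiv 𝓘(ℝ, Z) 𝓘(ℝ, W) m z₀) := by
    have := mfderiv_comp_of_eq (hf := hmd) (hg := hf) hm0
    rw [this]
    exact congrArg (β := Z →L[ℝ] Z) (fun w => (mfderiv 𝓘(ℝ, W) 𝓘(ℝ, Z) (π ∘ φ.symm) w : W →L[ℝ] Z).comp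
      (mfderiv 𝓘(ℝ, Z) 𝓘(ℝ, W) m z₀ : Z →L[ℝ] W)) hm0
  have h2 := mfderiv_comp u (IsSubmersion.mdifferentiableAt hπ _) hs
  refine ⟨(mfderiv 𝓘(ℝ, W) 𝓘(ℝ, W) φ.symm u).comp (mfderiv 𝓘(ℝ, Z) 𝓘(ℝ, W) m z₀ : Z →L[ℝ] W),
    fun Y => ?_⟩
  exact (DFunLike.congr_fun h2 _).symm.trans
    ((DFunLike.congr_fun h1 Y).symm.trans (DFunLike.congr_fun h0 Y))

omit [IsManifold 𝓘(ℝ, Z) ∞ Q] in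
-- Pulling back by the inverse chart and pushing forward again cancel, so the push-forward along `π`
-- may be computed in any chart of `N`.
theorem pushforwardAt_symm_eq (hπ : IsSubmersion 𝓘(ℝ, W) 𝓘(ℝ, Z) ∞ π)
    {φ : OpenPartialHomeomorph N W} (hφ : φ ∈ IsManifold.maximalAtlas 𝓘(ℝ, W) ∞ N) {w : W}
    (hw : w ∈ φ.target) :
    bigPushforward (mfderiv 𝓘(ℝ, W) 𝓘(ℝ, Z) (π ∘ φ.symm) w)
      (pullbackField (W := W) φ.symm L w) = pushforwardAt (W := W) π L (φ.symm w) := by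
  have hφd := mdifferentiable_of_mem_maximalAtlas hφ
  have h1 := mfderiv_comp w (IsSubmersion.mdifferentiableAt hπ _) (hφd.mdifferentiableAt_symm hw)
  refine (congrArg (fun l => bigPushforward l (pullbackField (W := W) φ.symm L w)) h1).trans ?_
  refine (bigPushforward_comp _ _ _).trans (congrArg _ ?_)
  refine bigPushforward_bigPullback (r := mfderiv 𝓘(ℝ, W) 𝓘(ℝ, W) φ (φ.symm w)) (fun y => ?_) _
  have h2 := hφd.symm_comp_deriv (φ.map_target hw)
  rw [φ.right_inv hw] at h2
  exact DFunLike.congr_fun h2 y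

/-- The push-forward is locally constant along the fibres of the submersion. -/
theorem eventually_pushforwardAt_eq (hπ : IsSubmersion 𝓘(ℝ, W) 𝓘(ℝ, Z) ∞ π)
    (hL : IsChartIntegrable r L)
    (hiso : ∀ x, L x ≤ bigOrthogonal L x)
    (hker : ∀ (x : N) (Y : TangentSpace 𝓘(ℝ, W) x), mfderiv 𝓘(ℝ, W) 𝓘(ℝ, Z) π x Y = 0 →
      ((Y, 0) : BigTangent W x) ∈ L x) (x : N) :
    ∀ᶠ x' in 𝓝 x, π x' = π x → (pushforwardAt (W := W) π L x' : Submodule ℝ (Big Z)) =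
      pushforwardAt (W := W) π L x := by
  obtain ⟨φ, hφ, u, hu, rfl, q, g, m, hg, hq, -⟩ := IsSubmersion.exists_adapted_chart hπ x
  have hφd := mdifferentiable_of_mem_maximalAtlas hφ
  have htarget : ∀ᶠ w in 𝓝 u, w ∈ φ.target := φ.open_target.mem_nhds hu
  -- In the adapted chart the derivative of `π` depends on `q w` only. Together with the constancy
  -- of `L` along `q`-fibres, this leaves nothing in the push-forward that varies along a fibre.
  have hder : ∀ w ∈ φ.target, (mfderiv 𝓘(ℝ, W) 𝓘(ℝ, Z) (π ∘ φ.symm) w : W →L[ℝ] Z) =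
      (mfderiv 𝓘(ℝ, Z) 𝓘(ℝ, Z) g (q w) : Z →L[ℝ] Z).comp q := by
    intro w hw
    have h1 : π ∘ φ.symm =ᶠ[𝓝 w] g ∘ q := by
      filter_upwards [φ.open_target.mem_nhds hw] with x hx using (hg x hx).1
    have h2 : mfderiv 𝓘(ℝ, W) 𝓘(ℝ, Z) (π ∘ φ.symm) w =
      mfderiv 𝓘(ℝ, W) 𝓘(ℝ, Z) (g ∘ q) w := h1.mfderiv_eq
    have h3 := mfderiv_comp w (hg w hw).2 q.differentiableAt.mdifferentiableAt
    have h4 : mfderiv 𝓘(ℝ, W) 𝓘(ℝ, Z) q w = q := mfderiv_eq_fderiv.trans q.fderiv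
    exact h2.trans (h3.trans (congrArg
      (fun l : W →L[ℝ] Z => (mfderiv 𝓘(ℝ, Z) 𝓘(ℝ, Z) g (q w) : Z →L[ℝ] Z).comp l) h4))
  obtain ⟨B, C, hC, hBC⟩ := hL.frame φ hφ u hu
  have hconst : ∀ᶠ w in 𝓝 u, q w = q u →
      (pullbackField (W := W) φ.symm L w : Submodule ℝ (Big W)) =
        pullbackField (W := W) φ.symm L u := by
    refine eventually_eq_of_bracket_closed
      (L := fun w => (pullbackField (W := W) φ.symm L w : Submodule ℝ (Big W))) hC hBC ?_ ?_ ?_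
    · filter_upwards [htarget] with w hw κ hκ
      refine ⟨0, hker _ _ ?_, rfl⟩
      have h1 := mfderiv_comp w (IsSubmersion.mdifferentiableAt hπ _)
        (hφd.mdifferentiableAt_symm hw)
      refine (DFunLike.congr_fun h1 κ).symm.trans ((DFunLike.congr_fun (hder w hw) κ).trans ?_)
      exact (congrArg (mfderiv 𝓘(ℝ, Z) 𝓘(ℝ, Z) g (q w)) hκ).trans (map_zero _)
    · exact Eventually.of_forall fun w => bigPullback_isotropic (hiso _)
    · filter_upwards [htarget] with w hw s t hs ht hsL htL
      exact hL.bracket φ hφ w hw s t hs ht hsL htL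
  have hev : ∀ᶠ x' in 𝓝 (φ.symm u), φ x' ∈ φ.target ∧ φ.symm (φ x') = x' ∧ (q (φ x') = q u →
      (pullbackField (W := W) φ.symm L (φ x') : Submodule ℝ (Big W)) =
        pullbackField (W := W) φ.symm L u) := by
    have hc := φ.continuousAt (φ.map_target hu)
    rw [ContinuousAt, φ.right_inv hu] at hc
    filter_upwards [hc.eventually hconst, φ.open_source.mem_nhds (φ.map_target hu)] with x' h1 h2
    exact ⟨φ.map_source h2, φ.left_inv h2, h1⟩
  filter_upwards [hev] with x' ⟨hw, hx', h⟩ hππ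
  generalize φ x' = w at hw hx' h
  subst hx'
  have hqw := hq w hw u hu hππ
  refine (pushforwardAt_symm_eq hπ hφ hw).symm.trans
    (Eq.trans ?_ (pushforwardAt_symm_eq (L := L) hπ hφ hu))
  refine congrArg₂ (fun (l : W →L[ℝ] Z) (S : Submodule ℝ (Big W)) => bigPushforward l S) ?_ (h hqw)
  refine (hder w hw).trans (Eq.trans ?_ (hder u hu).symm)
  exact congrArg (β := W →L[ℝ] Z) (fun z : Z => (mfderiv 𝓘(ℝ, Z) 𝓘(ℝ, Z) g z : Z →L[ℝ] Z).comp q) hqw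

/-- The push-forward descends to the base of a submersion with connected fibres. -/
theorem exists_reduced (hπ : IsSubmersion 𝓘(ℝ, W) 𝓘(ℝ, Z) ∞ π)
    (hfib : ∀ q : Q, IsConnected (π ⁻¹' {q})) (hL : IsChartIntegrable r L)
    (hiso : ∀ x, L x ≤ bigOrthogonal L x)
    (hker : ∀ (x : N) (Y : TangentSpace 𝓘(ℝ, W) x), mfderiv 𝓘(ℝ, W) 𝓘(ℝ, Z) π x Y = 0 →
      ((Y, 0) : BigTangent W x) ∈ L x) :
    ∃ E : ∀ q : Q, Submodule ℝ (BigTangent Z q),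
      ∀ x : N, E (π x) = pushforwardAt (W := W) π L x := by
  -- Values in a single type, so that local constancy on a fibre makes sense.
  let P : N → Submodule ℝ (Big Z) := fun x => pushforwardAt (W := W) π L x
  have hP : ∀ x x' : N, π x = π x' → P x = P x' := by
    intro x x' hxx'
    have : PreconnectedSpace (π ⁻¹' {π x'}) :=
      isPreconnected_iff_preconnectedSpace.1 (hfib (π x')).isPreconnected
    have hloc : IsLocallyConstant fun y : π ⁻¹' {π x'} => P y := by
      rw [IsLocallyConstant.iff_eventually_eq]
      intro y
      filter_upwards [continuousAt_subtype_val.eventually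
        (eventually_pushforwardAt_eq hπ hL hiso hker (y : N))] with y' h
      exact h (y'.2.trans y.2.symm)
    exact hloc.apply_eq_of_preconnectedSpace ⟨x, hxx'⟩ ⟨x', rfl⟩
  choose c hc using fun q => (hfib q).nonempty
  exact ⟨fun q => P (c q), fun x => hP _ _ (hc (π x))⟩

end Reduction

/-! ### Smoothness and integrability of the reduced structure. -/

section ReducedStructure

variable {W Z : Type*}
  [NormedAddCommGroup W] [NormedSpace ℝ W] [FiniteDimensional ℝ W]
  [NormedAddCommGroup Z] [NormedSpace ℝ Z] [FiniteDimensional ℝ Z]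
  {N : Type*} [TopologicalSpace N] [ChartedSpace W N]
  {Q : Type*} [TopologicalSpace Q] [ChartedSpace Z Q] [IsManifold 𝓘(ℝ, Z) ∞ Q]
  {π : N → Q} {L : ∀ x : N, Submodule ℝ (BigTangent W x)} {r : ℕ}
  {E : ∀ q : Q, Submodule ℝ (BigTangent Z q)}

omit [FiniteDimensional ℝ W] [FiniteDimensional ℝ Z] in
/-- The coordinate expression of a submersion pulls the coordinate expression of `E` back to that
of `L`. -/
theorem Manifold.IsSubmersion.coordinates (hπ : IsSubmersion 𝓘(ℝ, W) 𝓘(ℝ, Z) ∞ π)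
    (hEL : ∀ x, pullbackField (W := W) π E x = L x) {φ : OpenPartialHomeomorph N W}
    (hφ : φ ∈ IsManifold.maximalAtlas 𝓘(ℝ, W) ∞ N) {u : W} (hu : u ∈ φ.target) :
    SmoothNear (fun w => extChartAt 𝓘(ℝ, Z) (π (φ.symm u)) (π (φ.symm w))) u ∧
    ∀ᶠ w in 𝓝 u, (pullbackField (W := W) φ.symm L w : Submodule ℝ (Big W)) =
      bigPullback (fderiv ℝ (fun w => extChartAt 𝓘(ℝ, Z) (π (φ.symm u)) (π (φ.symm w))) w)
        (pullbackField (W := Z) (chartInv Z (π (φ.symm u))) E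
          (extChartAt 𝓘(ℝ, Z) (π (φ.symm u)) (π (φ.symm w))) : Submodule ℝ (Big Z)) := by
  have htarget : ∀ᶠ w in 𝓝 u, w ∈ φ.target := φ.open_target.mem_nhds hu
  have hf : ∀ᶠ w in 𝓝 u, ContMDiffAt 𝓘(ℝ, W) 𝓘(ℝ, Z) ∞ (π ∘ φ.symm) w := by
    filter_upwards [htarget] with w hw
    exact (hπ.isSubmersionAt _).contMDiffAt.comp w (contMDiffAt_symm_of_mem_maximalAtlas hφ hw)
  refine ⟨smoothNear_extChartAt_comp (V := Z) (f := fun w => π (φ.symm w)) hf, ?_⟩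
  filter_upwards [eventually_pullbackField_eq hf E, htarget] with w h1 hw
  have h2 : pullbackField (W := W) (π ∘ φ.symm) E w =
      pullbackField (W := W) φ.symm (pullbackField (W := W) π E) w :=
    pullbackField_comp (IsSubmersion.mdifferentiableAt hπ _)
      ((mdifferentiable_of_mem_maximalAtlas hφ).mdifferentiableAt_symm hw) E
  have h3 : pullbackField (W := W) π E = L := funext hEL
  rw [h3] at h2
  exact h2.symm.trans h1

omit [FiniteDimensional ℝ W] in
-- Two sections of `E` lift locally to related sections of `π^*E = L`. Their bracket lies in `L` and
-- is related to the bracket below, which therefore lies in `E`.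
theorem isCourantClosed_of_pullbackField_eq (hπ : IsSubmersion 𝓘(ℝ, W) 𝓘(ℝ, Z) ∞ π)
    (hsurj : Function.Surjective π) (hL : IsChartIntegrable r L)
    (hEL : ∀ x, pullbackField (W := W) π E x = L x) : IsCourantClosed E := by
  intro σ τ hσ hτ hσE hτE y
  obtain ⟨x, rfl⟩ := hsurj y
  obtain ⟨φ, hφ, u, hu, rfl, q, g, m, -, -, hm, hm0, hπm⟩ :=
    IsSubmersion.exists_adapted_chart hπ x
  obtain ⟨hp, hpL⟩ := IsSubmersion.coordinates hπ hEL hφ hu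
  set y := π (φ.symm u)
  set p : W → Z := fun w => extChartAt 𝓘(ℝ, Z) y (π (φ.symm w))
  have hpm : ∀ᶠ z in 𝓝 (extChartAt 𝓘(ℝ, Z) y y), p (m z) = z := by
    filter_upwards [hπm, extChartAt_target_mem_nhds_self (V := Z) y] with z h1 h2
    simp only [p, h1]
    exact (extChartAt 𝓘(ℝ, Z) y).right_inv h2
  have hT := (eventually_fderiv_leftInverse hm (by rwa [hm0]) hpm).self_of_nhds
  rw [hm0] at hT
  have key : ∀ σ : ∀ q : Q, BigTangent Z q, IsSmoothBigSectionOn σ Set.univ → (∀ q, σ q ∈ E q) →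
      ∃ s : W → Big W, SmoothNear s u ∧ (∀ᶠ w in 𝓝 u, BigRelated p s (chartSection y σ) w) ∧
        ∀ᶠ w in 𝓝 u, s w ∈ (pullbackField (W := W) φ.symm L w : Submodule ℝ (Big W)) := by
    intro σ hσ hσE
    have hS : SmoothNear (chartSection y σ) (p u) := smoothNear_chartSection univ_mem hσ
    obtain ⟨s, hs, hsS⟩ := exists_related_lift_of_section hp hT hS
    refine ⟨s, hs, hsS, ?_⟩
    have htgt : ∀ᶠ w in 𝓝 u, p w ∈ (extChartAt 𝓘(ℝ, Z) y).target :=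
      hp.continuousAt.eventually (extChartAt_target_mem_nhds_self (V := Z) y)
    filter_upwards [hsS, hpL, htgt] with w h1 h2 h3
    refine h2.ge ⟨_, ?_, h1.2⟩
    rw [← h1.1]
    exact (chartSection_mem_iff h3 E σ).2 (hσE _)
  obtain ⟨s, hs, hsS, hsL⟩ := key σ hσ hσE
  obtain ⟨t, ht, htT, htL⟩ := key τ hτ hτE
  have h1 := hL.bracket φ hφ u hu s t hs ht hsL htL
  have hS : DifferentiableAt ℝ (chartSection y σ) (p u) :=
    (smoothNear_chartSection univ_mem hσ).differentiableAt
  have hT' : DifferentiableAt ℝ (chartSection y τ) (p u) :=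
    (smoothNear_chartSection univ_mem hτ).differentiableAt
  have h2 := BigRelated.flatBracket hp.contDiffAt hs.differentiableAt ht.differentiableAt
    hS hT' hsS htT
  have h3 := hpL.self_of_nhds.le h1
  -- Since `dp` is onto, a covector is determined by its pullback, so membership in the pullback of
  -- `E` can be read back as membership in `E`.
  have h4 : (fderiv ℝ p u (flatBracket s t u).1,
      (flatBracket (chartSection y σ) (chartSection y τ) (p u)).2) ∈
      (pullbackField (W := Z) (chartInv Z y) E (p u) : Submodule ℝ (Big Z)) := by
    refine mem_of_mem_bigPullback (l := fderiv ℝ p u) (fun z => ⟨_, hT z⟩) ?_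
    rw [← h2.2]
    exact h3
  rw [← h2.1] at h4
  have h5 := (pullbackField_chartInv_self E y).le h4
  exact (courantBracket_eq_flatBracket univ_mem hσ hτ).symm ▸ h5

/-- A frame of `L` is restricted to a local section of `π` and projected to `Q`. The rank drops by
the fibre dimension because `π^*E` contains `ker dπ ⊕ 0`; where `Q` has a point the subtraction is
exact. -/
theorem isSmoothBigSubbundle_of_pullbackField_eq (hπ : IsSubmersion 𝓘(ℝ, W) 𝓘(ℝ, Z) ∞ π)
    (hsurj : Function.Surjective π) (hL : IsChartIntegrable r L)
    (hEL : ∀ x, pullbackField (W := W) π E x = L x) :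
    IsSmoothBigSubbundle (r + Module.finrank ℝ Z - Module.finrank ℝ W) E := by
  refine isSmoothBigSubbundle_of_smoothNear fun y => ?_
  obtain ⟨x, rfl⟩ := hsurj y
  obtain ⟨φ, hφ, u, hu, rfl, q, g, m, -, -, hm, hm0, hπm⟩ :=
    IsSubmersion.exists_adapted_chart hπ x
  obtain ⟨hp, hpL⟩ := IsSubmersion.coordinates hπ hEL hφ hu
  obtain ⟨B, C, hC, hBC⟩ := hL.frame φ hφ u hu
  set y := π (φ.symm u)
  set p : W → Z := fun w => extChartAt 𝓘(ℝ, Z) y (π (φ.symm w))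
  set z₀ := extChartAt 𝓘(ℝ, Z) y y
  have hpm : ∀ᶠ z in 𝓝 z₀, p (m z) = z := by
    filter_upwards [hπm, extChartAt_target_mem_nhds_self (V := Z) y] with z h1 h2
    simp only [p, h1]
    exact (extChartAt 𝓘(ℝ, Z) y).right_inv h2
  have hp' : SmoothNear p (m z₀) := by rwa [hm0]
  have hC' : SmoothNear C (m z₀) := by rwa [hm0]
  have hT := eventually_fderiv_leftInverse hm hp' hpm
  have hmc : Tendsto m (𝓝 z₀) (𝓝 u) := hm0 ▸ hm.continuousAt
  -- `Φ z` is `dp` on vectors and `(dm)^*` on covectors. As `dm` is a right inverse of `dp`, it maps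
  -- `(dp)^*E` onto `E`.
  let Φ : Z → Big W →L[ℝ] Big Z := fun z =>
    ((fderiv ℝ p (m z)).comp (ContinuousLinearMap.fst ℝ W (W →L[ℝ] ℝ))).prod
      ((precompMap (fderiv ℝ m z)).comp (ContinuousLinearMap.snd ℝ W (W →L[ℝ] ℝ)))
  have hΦ : SmoothNear Φ z₀ := SmoothNear.clm_prod ((hp'.fderiv.comp hm).clm_comp (.const _))
    (hm.fderiv.precompMap.clm_comp (.const _))
  let A : Z → (Fin r → ℝ) →L[ℝ] Big Z := fun z => (Φ z).comp (C (m z))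
  have hA : SmoothNear A z₀ := hΦ.clm_comp (hC'.comp hm)
  have hAE : ∀ᶠ z in 𝓝 z₀, LinearMap.range (A z).toLinearMap =
      (pullbackField (W := Z) (chartInv Z y) E z : Submodule ℝ (Big Z)) ∧
      Module.finrank ℝ (LinearMap.range (A z).toLinearMap) =
        r + Module.finrank ℝ Z - Module.finrank ℝ W := by
    filter_upwards [hT, hpm, hmc.eventually hpL, hmc.eventually hBC] with z h1 h2 h3 h4
    have h5 : LinearMap.range (C (m z)).toLinearMap = bigPullback (fderiv ℝ p (m z))
        (pullbackField (W := Z) (chartInv Z y) E z : Submodule ℝ (Big Z)) := by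
      have h6 := h4.2.trans h3
      have h7 : p (m z) = z := h2
      refine h6.trans ?_
      exact congrArg (fun z' => bigPullback (fderiv ℝ p (m z))
        (pullbackField (W := Z) (chartInv Z y) E z' : Submodule ℝ (Big Z))) h7
    have h6 : LinearMap.range (A z).toLinearMap =
        (LinearMap.range (C (m z)).toLinearMap).map (Φ z).toLinearMap :=
      LinearMap.range_comp _ _
    have h7 : LinearMap.range (A z).toLinearMap =
        (pullbackField (W := Z) (chartInv Z y) E z : Submodule ℝ (Big Z)) := by
      rw [h6, h5]
      exact map_bigPullback_of_section h1 _ _ fun _ => rfl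
    refine ⟨h7, ?_⟩
    have h8 := finrank_bigPullback_of_surjective (l := fderiv ℝ p (m z)) (fun Y => ⟨_, h1 Y⟩)
      (pullbackField (W := Z) (chartInv Z y) E z : Submodule ℝ (Big Z))
    have h9 : Module.finrank ℝ (LinearMap.range (C (m z)).toLinearMap) = r := by
      have hinj : Function.Injective (C (m z)) := Function.LeftInverse.injective h4.1
      rw [LinearMap.finrank_range_of_inj hinj, Module.finrank_fin_fun]
    rw [← h5, h9, ← h7] at h8
    omega
  -- The `r` sections given by `A` span `E` but may be dependent; the constant rank permits
  -- extracting a frame.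
  obtain ⟨B', C', hC'', hBC'⟩ := exists_smooth_frame_range hA (hAE.mono fun _ h => h.2)
  refine ⟨fun z => (A z).comp (C' z), hA.clm_comp hC'', ?_⟩
  filter_upwards [hAE, hBC'] with z h1 h2
  exact ⟨Function.LeftInverse.injective (g := B') h2.1, h2.2.trans h1.1⟩

end ReducedStructure

end

/-! ### The reduction theorem. -/

theorem proposition5p6
    {V W Z : Type*}
    [NormedAddCommGroup V] [NormedSpace ℝ V] [FiniteDimensional ℝ V]
    [NormedAddCommGroup W] [NormedSpace ℝ W] [FiniteDimensional ℝ W]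
    [NormedAddCommGroup Z] [NormedSpace ℝ Z] [FiniteDimensional ℝ Z]
    {M : Type*} [TopologicalSpace M] [ChartedSpace V M] [IsManifold 𝓘(ℝ, V) ∞ M] [T2Space M]
    {N : Type*} [TopologicalSpace N] [ChartedSpace W N] [IsManifold 𝓘(ℝ, W) ∞ N] [T2Space N]
    {Q : Type*} [TopologicalSpace Q] [ChartedSpace Z Q] [IsManifold 𝓘(ℝ, Z) ∞ Q] [T2Space Q]
    (k : ℕ) (E : ∀ y : M, Submodule ℝ (BigTangent V y))
    (hE : IsBigIsotropic k E) (hEint : IsCourantClosed E)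
    (ι : N → M) (hι : IsSmoothEmbedding 𝓘(ℝ, W) 𝓘(ℝ, V) ∞ ι)
    (hS : ∃ d : ℕ, ∀ x : N, Module.finrank ℝ (tangentialPart (W := W) ι E x) = d)
    (hS' : ∃ d : ℕ, ∀ x : N, Module.finrank ℝ (tangentialPart (W := W) ι (bigOrthogonal E) x) = d)
    (π : N → Q) (hπ : IsSubmersion 𝓘(ℝ, W) 𝓘(ℝ, Z) ∞ π)
    (hfib : ∀ q : Q, IsConnected (π ⁻¹' {q}))
    (hr : IsReducible (W := W) (Z := Z) ι π E) :
    ∃! Ered : ∀ q : Q, Submodule ℝ (BigTangent Z q),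
      (∃ r : ℕ, IsBigIsotropic r Ered) ∧ IsCourantClosed Ered ∧
      (∀ x : N, Ered (π x) = pushforwardAt (W := W) π (pullbackField (W := W) ι E) x) ∧
      (∀ x : N, pullbackField (W := W) π Ered x = pullbackField (W := W) ι E x) := by
  obtain ⟨d, hd⟩ := hS
  obtain ⟨d', hd'⟩ := hS'
  obtain ⟨r, hL⟩ := exists_isChartIntegrable_pullbackField hE.subbundle hEint hι.isImmersion hd hd'
  have hsurj : Function.Surjective π := fun q => (hfib q).nonempty
  have hiso : ∀ x, pullbackField (W := W) ι E x ≤ bigOrthogonal (pullbackField (W := W) ι E) x :=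
    fun x => bigPullback_isotropic (hE.isotropic _)
  have hker : ∀ (x : N) (Y : TangentSpace 𝓘(ℝ, W) x), mfderiv 𝓘(ℝ, W) 𝓘(ℝ, Z) π x Y = 0 →
      ((Y, 0) : BigTangent W x) ∈ pullbackField (W := W) ι E x := by
    intro x Y hY
    obtain ⟨α, h1, h2⟩ := hr x Y hY
    -- The covector provided by reducibility annihilates `TN`, so its pullback to `N` is zero.
    exact ⟨α, h2, (ContinuousLinearMap.ext h1).symm⟩
  obtain ⟨Ered, hEred⟩ := exists_reduced hπ hfib hL hiso hker
  have hpull : ∀ x : N, pullbackField (W := W) π Ered x = pullbackField (W := W) ι E x := by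
    intro x
    obtain ⟨R, hR⟩ := IsSubmersion.exists_rightInverse_mfderiv hπ x
    exact (congrArg (bigPullback _) (hEred x)).trans
      (bigPullback_bigPushforward hR (hker x) (hiso x))
  refine ⟨Ered, ⟨⟨_, isSmoothBigSubbundle_of_pullbackField_eq hπ hsurj hL hpull, ?_⟩,
    isCourantClosed_of_pullbackField_eq hπ hsurj hL hpull, hEred, hpull⟩, ?_⟩
  · intro q
    obtain ⟨x, rfl⟩ := hsurj q
    unfold bigOrthogonal
    rw [hEred x]
    exact bigPushforward_isotropic (hiso x)
  -- The push-forward identity alone fixes the structure at every point of `π(N) = Q`.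
  · rintro E' ⟨-, -, h, -⟩
    funext q
    obtain ⟨x, rfl⟩ := hsurj q
    rw [h x, hEred x]
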